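/- An exponential polynomial is a function $\psi(z)=\sum_{j=1}^{l} b_j e^{2\pi i\alpha_j z}$ on $\mathbb{C}$ with $\alpha_j\in\mathbb{R}$ and $b_j\in\mathbb{C}$; let $\Lambda_\psi=\{z\in\mathbb{C}:\psi(z)=0\}$. Let $\psi$ and $\varphi$ be exponential polynomials such that all zeros of $\varphi$ are simple, $\Lambda_\varphi$ is uniformly discrete (i.e. $\inf\{|\lambda-\lambda'|:\lambda,\lambda'\in\Lambda_\varphi,\ \lambda\neq\lambda'\}>0$), and $\Lambda_\varphi\not\subset\Lambda_\psi$. Put $c_\lambda=\psi(\lambda)/\varphi'(\lambda)$ for $\lambda\in\Lambda_\varphi$, and $\hat f(s)=\int_{\mathbb{R}}f(x)e^{-2\pi i s x}\,dx$. Then the family $(c_\lambda)_{\lambda\in\Lambda_\varphi}$ is bounded, and there are a locally finite set $S\subset\mathbb{R}$, coefficients $a_s\in\mathbb{C}$ $(s\in S)$ and constants $C,m$ with $\#(S\cap(-r,r))\le C r^m$ for all $r>1$, such that the following hold. (i) For every entire function $f$ that is bounded on each horizontal strip $\{|\mathrm{Im}\,z|\le r\}$, $r>0$, and for which $x\mapsto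 f(x+iy)$ is in the Schwartz space $S(\mathbb{R})$ for each fixed $y\in\mathbb{R}$, $$\sum_{\lambda\in\Lambda_\varphi}c_\lambda f(\lambda)=\sum_{s\in S}a_s\hat f(s),$$ where both series converge absolutely. (ii) If moreover $\Lambda_\varphi\subset\mathbb{R}$, then, with the same $S$ and $a_s$, the family $(a_s)_{s\in S}$ is bounded and the formula in (i) holds, with both series absolutely convergent, for every $f\in S(\mathbb{R})$. -/

import Mathlib

open scoped FourierTransform SchwartzMap

/-- A set of complex numbers is uniformly discrete if the distances between its distinct points
have a positive infimum. -/
def UniformlyDiscrete (Z : Set ℂ) : Prop :=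
  ∃ δ : ℝ, 0 < δ ∧ ∀ z ∈ Z, ∀ w ∈ Z, z ≠ w → δ ≤ ‖z - w‖

/-- The zero set of a function on the complex plane. -/
def zeroSet (ψ : ℂ → ℂ) : Set ℂ := {z | ψ z = 0}

/-- Exponential polynomials `∑ⱼ bⱼ exp (2 π i αⱼ z)` with real `αⱼ` and complex `bⱼ`. -/
def ExpPoly : Set (ℂ → ℂ) :=
  {ψ | ∃ (l : ℕ) (α : Fin l → ℝ) (b : Fin l → ℂ),
    ∀ z : ℂ, ψ z = ∑ j, b j * Complex.exp (2 * Real.pi * Complex.I * α j * z)}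

/-- Exponential polynomials all of whose zeros are simple, with uniformly discrete zero set. -/
def ExpPolySimple : Set (ℂ → ℂ) :=
  {φ | φ ∈ ExpPoly ∧ (∀ z ∈ zeroSet φ, deriv φ z ≠ 0) ∧ UniformlyDiscrete (zeroSet φ)}

/-- The members of `ExpPolySimple` all of whose zeros are real. -/
def ExpPolyReal : Set (ℂ → ℂ) :=
  {φ | φ ∈ ExpPolySimple ∧ ∀ z ∈ zeroSet φ, z.im = 0}

/-- A locally finite set of reals with at most `C * r ^ m` points in `(-r, r)`, for `r > 1`. -/
def HasPolynomialCount (S : Set ℝ) : Prop :=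
  ∃ (C : ℝ) (m : ℕ), ∀ r : ℝ, 1 < r →
    (S ∩ Set.Ioo (-r) r).Finite ∧ ((S ∩ Set.Ioo (-r) r).ncard : ℝ) ≤ C * r ^ m

/-- Entire functions that are bounded on every horizontal strip and whose restriction to every
horizontal line is a Schwartz function. -/
structure IsEntireSchwartz (f : ℂ → ℂ) : Prop where
  entire : Differentiable ℂ f
  schwartz : ∀ y : ℝ, ∃ g : 𝓢(ℝ, ℂ), ∀ x : ℝ, g x = f (x + y * Complex.I)
  bounded : ∀ r : ℝ, ∃ M : ℝ, ∀ z : ℂ, |z.im| ≤ r → ‖f z‖ ≤ M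

/-! ### Gaussians as test functions -/

section Gaussian

/-! The formula is the residue theorem for `f ψ / φ`. All zeros of `φ` lie in a strip `|Im z| < H`,
and the `c_λ` are the residues of `ψ / φ`. On `Im z = H` the term of lowest frequency of `φ`
dominates, so a geometric series writes `ψ / φ` as an absolutely convergent exponential series; the
reflection `z ↦ -z` gives the same on `Im z = -H` (`exists_expansion_upper`). Its frequencies are
finitely many translates of a monoid generated by finitely many positive reals, whence the
polynomial count. Integrating termwise and moving each line to the real axis produces values of the
Fourier transform of `f`.

To close the contours, `φ` must be bounded below on vertical segments arbitrarily far out.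
Translating `φ` by a real number only rotates its coefficients, so all translates lie in a family
over the compact space `ℝ → Circle`, none of whose members vanishes identically. Each member has
countably many zeros and hence a zero-free segment, and compactness makes the lower bound uniform
(`exists_uniform_lower_bound`). The same argument on small circles, with the minimum modulus
principle for `φ(z)/(z-λ)`, bounds `|φ'(λ)|` from below, so `c_λ` is bounded.

If the zeros are real, testing with modulated Gaussians that become ever wider isolates a single
`a_s`; uniform discreteness of the zeros keeps the other side bounded (`bounded_dual_coefficients`).
A Schwartz function is then approximated by its convolutions with narrow Gaussians, which are entire
test functions, and both sides pass to the limit by dominated convergence (`formula_of_schwartz`).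
-/

theorem norm_polynomial_eval_le_exp (p : Polynomial ℂ) (k : ℕ) :
    ∃ C : ℝ, 0 ≤ C ∧ ∀ x : ℝ, |x| ^ k * ‖p.eval (x : ℂ)‖ ≤ C * Real.exp |x| := by
  induction p using Polynomial.induction_on' with
  | add p q hp hq =>
    obtain ⟨C, hC, h⟩ := hp
    obtain ⟨D, hD, h'⟩ := hq
    refine ⟨C + D, by positivity, fun x => ?_⟩
    rw [Polynomial.eval_add]
    calc |x| ^ k * ‖p.eval (x : ℂ) + q.eval (x : ℂ)‖
        ≤ |x| ^ k * (‖p.eval (x : ℂ)‖ + ‖q.eval (x : ℂ)‖) := by gcongr; exact norm_add_le _ _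
      _ ≤ (C + D) * Real.exp |x| := by rw [mul_add, add_mul]; exact add_le_add (h x) (h' x)
  | monomial n a =>
    -- The constant comes from `t ^ N / N! ≤ exp t` with `N = k + n`.
    refine ⟨‖a‖ * (k + n).factorial, by positivity, fun x => ?_⟩
    have h := Real.pow_div_factorial_le_exp |x| (abs_nonneg x) (k + n)
    rw [div_le_iff₀ (by positivity)] at h
    rw [Polynomial.eval_monomial, norm_mul, norm_pow, Complex.norm_real, Real.norm_eq_abs]
    calc |x| ^ k * (‖a‖ * |x| ^ n) = ‖a‖ * |x| ^ (k + n) := by ring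
      _ ≤ ‖a‖ * (Real.exp |x| * (k + n).factorial) := by gcongr
      _ = _ := by ring

/-- Each differentiation multiplies by the polynomial `-2bx + c` and differentiates the previous
factor, so the shape is preserved and the Schwartz seminorms reduce to polynomial bounds. -/
theorem iteratedDeriv_cexp_quadratic (b c d : ℂ) (n : ℕ) :
    ∃ p : Polynomial ℂ, iteratedDeriv n (fun x : ℝ => Complex.exp (-b * x ^ 2 + c * x + d)) =
      fun x : ℝ => p.eval (x : ℂ) * Complex.exp (-b * x ^ 2 + c * x + d) := by
  induction n with
  | zero => exact ⟨1, by simp⟩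
  | succ n ih =>
    obtain ⟨p, hp⟩ := ih
    refine ⟨Polynomial.derivative p +
      p * (Polynomial.C (-2 * b) * Polynomial.X + Polynomial.C c), ?_⟩
    rw [iteratedDeriv_succ, hp]
    funext x
    have h2 : HasDerivAt (fun z : ℂ => Complex.exp (-b * z ^ 2 + c * z + d))
        (Complex.exp (-b * x ^ 2 + c * x + d) * (-b * (2 * x) + c)) x := by
      refine HasDerivAt.cexp ?_
      have := ((((hasDerivAt_id (x : ℂ)).pow 2).const_mul (-b)).add
        ((hasDerivAt_id (x : ℂ)).const_mul c)).add_const d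
      convert! this using 1
      simp
    have h3 := ((p.hasDerivAt (x : ℂ)).mul h2).comp_ofReal
    have h4 := h3.deriv
    simp only [Pi.mul_apply] at h4
    rw [h4]
    simp only [Polynomial.eval_add, Polynomial.eval_mul, Polynomial.eval_C, Polynomial.eval_X]
    ring

theorem norm_cexp_quadratic (b : ℝ) (c d : ℂ) (x y : ℝ) :
    ‖Complex.exp (-b * (x + y * Complex.I) ^ 2 + c * (x + y * Complex.I) + d)‖ =
      Real.exp (-b * x ^ 2 + c.re * x + (b * y ^ 2 - c.im * y + d.re)) := by
  rw [Complex.norm_exp]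
  congr 1
  simp [pow_two]
  ring

theorem neg_mul_sq_add_mul_le {b : ℝ} (hb : 0 < b) (γ x : ℝ) :
    -b * x ^ 2 + γ * x ≤ γ ^ 2 / (4 * b) := by
  rw [le_div_iff₀ (by positivity)]
  nlinarith [sq_nonneg (2 * b * x - γ)]

/-- The function `x ↦ exp (-b x² + c x + d)` with `b > 0` is a Schwartz function. -/
theorem exists_schwartz_cexp_quadratic {b : ℝ} (hb : 0 < b) (c d : ℂ) :
    ∃ g : 𝓢(ℝ, ℂ), ∀ x : ℝ, g x = Complex.exp (-b * x ^ 2 + c * x + d) := by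
  refine ⟨⟨fun x => Complex.exp (-b * x ^ 2 + c * x + d), by
    have : ContDiff ℝ ((⊤ : ℕ∞) : WithTop ℕ∞) (fun x : ℝ => (x : ℂ)) := Complex.ofRealCLM.contDiff
    fun_prop, ?_⟩, fun x => rfl⟩
  intro k n
  obtain ⟨p, hp⟩ := iteratedDeriv_cexp_quadratic b c d n
  obtain ⟨C, hC, h⟩ := norm_polynomial_eval_le_exp p k
  -- The factor `exp |x|` from the polynomial raises the linear coefficient to at most `1 + |Re c|`;
  -- the exponent is the resulting maximum of the quadratic in `|x|`.
  refine ⟨C * Real.exp ((1 + |c.re|) ^ 2 / (4 * b) + d.re), fun x => ?_⟩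
  rw [norm_iteratedFDeriv_eq_norm_iteratedDeriv, hp, norm_mul, Real.norm_eq_abs]
  have h1 := norm_cexp_quadratic b c d x 0
  simp only [Complex.ofReal_zero, zero_mul, add_zero] at h1
  rw [h1, ← mul_assoc]
  calc |x| ^ k * ‖p.eval (x : ℂ)‖ * Real.exp (-b * x ^ 2 + c.re * x + (b * 0 ^ 2 - c.im * 0 + d.re))
      ≤ C * Real.exp |x| *
        Real.exp (-b * x ^ 2 + c.re * x + (b * 0 ^ 2 - c.im * 0 + d.re)) := by
        exact mul_le_mul_of_nonneg_right (h x) (Real.exp_nonneg _)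
    _ = C * Real.exp (|x| + (-b * x ^ 2 + c.re * x + d.re)) := by
        rw [mul_assoc, ← Real.exp_add]; ring_nf
    _ ≤ _ := by
        gcongr ?_ * Real.exp ?_
        have h2 := neg_mul_sq_add_mul_le hb (1 + |c.re|) |x|
        rw [sq_abs] at h2
        have h3 : c.re * x ≤ |c.re| * |x| := by rw [← abs_mul]; exact le_abs_self _
        linarith

/-- Entire Gaussians are test functions. -/
theorem isEntireSchwartz_cexp_quadratic {b : ℝ} (hb : 0 < b) (c d : ℂ) :
    IsEntireSchwartz (fun z => Complex.exp (-b * z ^ 2 + c * z + d)) where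
  entire := by fun_prop
  schwartz y := by
    obtain ⟨g, hg⟩ := exists_schwartz_cexp_quadratic hb (c - 2 * b * y * Complex.I)
      (d + b * y ^ 2 + c * y * Complex.I)
    refine ⟨g, fun x => ?_⟩
    rw [hg]
    congr 1
    linear_combination (b : ℂ) * y ^ 2 * Complex.I_sq
  bounded r := by
    refine ⟨Real.exp (c.re ^ 2 / (4 * b) + (b * r ^ 2 + |c.im| * r + d.re)), fun z hz => ?_⟩
    have h := norm_cexp_quadratic b c d z.re z.im
    rw [Complex.re_add_im] at h
    rw [h]
    gcongr
    · exact neg_mul_sq_add_mul_le hb _ _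
    · have h1 : z.im ^ 2 ≤ r ^ 2 := sq_le_sq' (abs_le.1 hz).1 (abs_le.1 hz).2
      have h2 : -(c.im * z.im) ≤ |c.im| * r := by
        calc -(c.im * z.im) ≤ |c.im * z.im| := neg_le_abs _
          _ = |c.im| * |z.im| := abs_mul _ _
          _ ≤ _ := by gcongr
      nlinarith

end Gaussian

/-! ### Counting frequencies -/

section PolynomialCount

theorem HasPolynomialCount.union {S T : Set ℝ} (hS : HasPolynomialCount S)
    (hT : HasPolynomialCount T) : HasPolynomialCount (S ∪ T) := by
  obtain ⟨C, m, h⟩ := hS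
  obtain ⟨D, n, h'⟩ := hT
  refine ⟨|C| + |D|, max m n, fun r hr => ?_⟩
  rw [Set.union_inter_distrib_right]
  refine ⟨(h r hr).1.union (h' r hr).1, ?_⟩
  have h1 : ((S ∩ Set.Ioo (-r) r ∪ T ∩ Set.Ioo (-r) r).ncard : ℝ) ≤
      (S ∩ Set.Ioo (-r) r).ncard + (T ∩ Set.Ioo (-r) r).ncard := by
    exact_mod_cast Set.ncard_union_le _ _
  have h2 : C * r ^ m ≤ |C| * r ^ max m n := by
    gcongr
    · exact le_abs_self C
    · exact hr.le
    · exact le_max_left _ _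
  have h3 : D * r ^ n ≤ |D| * r ^ max m n := by
    gcongr
    · exact le_abs_self D
    · exact hr.le
    · exact le_max_right _ _
  have := (h r hr).2
  have := (h' r hr).2
  linarith

theorem HasPolynomialCount.neg {S : Set ℝ} (hS : HasPolynomialCount S) :
    HasPolynomialCount ((fun x => -x) '' S) := by
  obtain ⟨C, m, h⟩ := hS
  refine ⟨C, m, fun r hr => ?_⟩
  have h1 : (fun x => -x) '' S ∩ Set.Ioo (-r) r = (fun x => -x) '' (S ∩ Set.Ioo (-r) r) := by
    rw [Set.image_inter neg_injective]
    simp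
  rw [h1, Set.ncard_image_of_injective _ neg_injective]
  exact ⟨(h r hr).1.image _, (h r hr).2⟩

/-- Finitely many translates of the additive monoid generated by finitely many positive reals have
polynomial growth. -/
theorem hasPolynomialCount_range_words {A J : Type*} [Finite A] [Finite J] (a : A → ℝ) (γ : J → ℝ)
    (hγ : ∀ j, 0 < γ j) :
    HasPolynomialCount
      (Set.range fun p : A × (Σ k : ℕ, (Fin k → J)) => a p.1 + ∑ i, γ (p.2.2 i)) := by
  classical
  cases nonempty_fintype A
  cases nonempty_fintype J
  obtain ⟨g, hg, hgγ⟩ : ∃ g : ℝ, 0 < g ∧ ∀ j, g ≤ γ j := by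
    rcases isEmpty_or_nonempty J with hJ | hJ
    · exact ⟨1, one_pos, fun j => hJ.elim j⟩
    · obtain ⟨j, hj⟩ := Finite.exists_min γ
      exact ⟨γ j, hγ j, hj⟩
  obtain ⟨M, hM⟩ : ∃ M : ℝ, ∀ i, |a i| ≤ M := by
    obtain ⟨M, hM⟩ := (Set.finite_range fun i => |a i|).bddAbove
    exact ⟨M, fun i => hM ⟨i, rfl⟩⟩
  have hM' : ∀ i, |a i| ≤ |M| := fun i => (hM i).trans (le_abs_self M)
  refine ⟨Fintype.card A * ((1 + |M|) / g + 1) ^ Fintype.card J, Fintype.card J, fun r hr => ?_⟩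
  -- A word with value below `r` has at most `K` letters, since each letter adds at least `g` and
  -- the translate is at least `-|M|`.
  set K := ⌊(r + |M|) / g⌋₊ with hK
  -- The value of a word depends only on how often each letter occurs, so the count is polynomial
  -- although the number of words is exponential.
  let F : A × (J → Fin (K + 1)) → ℝ := fun p => a p.1 + ∑ j, (p.2 j : ℕ) * γ j
  have hsub : (Set.range fun p : A × (Σ k : ℕ, (Fin k → J)) => a p.1 + ∑ i, γ (p.2.2 i)) ∩
      Set.Ioo (-r) r ⊆ Set.range F := by
    rintro _ ⟨⟨⟨i, k, p⟩, rfl⟩, hlt⟩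
    simp only [Set.mem_Ioo] at hlt
    have h1 : (k : ℝ) * g ≤ ∑ i, γ (p i) := by
      calc (k : ℝ) * g = ∑ i : Fin k, g := by simp
        _ ≤ _ := Finset.sum_le_sum fun i _ => hgγ _
    have h2 : k ≤ K := by
      refine Nat.le_floor ?_
      rw [le_div_iff₀ hg]
      have := (abs_le.1 (hM' i)).1
      linarith [hlt.2]
    refine ⟨⟨i, fun j => ⟨(Finset.univ.filter fun l => p l = j).card, ?_⟩⟩, ?_⟩
    · refine Nat.lt_succ_of_le (le_trans (Finset.card_le_univ _) ?_)
      simpa using h2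
    · simp only [F]
      congr 1
      rw [← Finset.sum_fiberwise Finset.univ p]
      refine Finset.sum_congr rfl fun j _ => ?_
      rw [Finset.sum_congr rfl (g := fun _ => γ j)
        (fun l hl => by rw [(Finset.mem_filter.1 hl).2])]
      simp
  refine ⟨(Set.finite_range F).subset hsub, ?_⟩
  have h1 : (((Set.range fun p : A × (Σ k : ℕ, (Fin k → J)) => a p.1 + ∑ i, γ (p.2.2 i)) ∩
      Set.Ioo (-r) r).ncard : ℝ) ≤ (Set.range F).ncard := by
    exact_mod_cast Set.ncard_le_ncard hsub (Set.finite_range F)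
  have h2 : ((Set.range F).ncard : ℝ) ≤ Fintype.card A * ((K : ℝ) + 1) ^ Fintype.card J := by
    have : (Set.range F).ncard ≤ Nat.card (A × (J → Fin (K + 1))) := by
      rw [← Set.image_univ, ← Set.ncard_univ]
      exact Set.ncard_image_le
    rw [Nat.card_eq_fintype_card] at this
    simp only [Fintype.card_prod, Fintype.card_fun, Fintype.card_fin] at this
    exact_mod_cast this
  have h3 : (K : ℝ) + 1 ≤ ((1 + |M|) / g + 1) * r := by
    have : (K : ℝ) ≤ (r + |M|) / g := Nat.floor_le (by positivity)
    have h4 : (r + |M|) / g ≤ (1 + |M|) / g * r := by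
      rw [div_mul_eq_mul_div]
      gcongr
      nlinarith [abs_nonneg M]
    linarith
  calc _ ≤ _ := h1
    _ ≤ _ := h2
    _ ≤ Fintype.card A * (((1 + |M|) / g + 1) * r) ^ Fintype.card J := by gcongr
    _ = _ := by rw [mul_pow, mul_assoc]

end PolynomialCount

/-! ### Exponential sums and the expansion of their quotients -/

section ExpSum

/-- The geometric series of a finite sum, expanded over words. -/
theorem hasSum_words {J : Type*} [Fintype J] (u : J → ℂ) (h : ∑ j, ‖u j‖ < 1) :
    Summable (fun p : Σ k : ℕ, (Fin k → J) => ‖∏ i, u (p.2 i)‖) ∧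
      HasSum (fun p : Σ k : ℕ, (Fin k → J) => ∏ i, u (p.2 i)) (1 - ∑ j, u j)⁻¹ := by
  have hs : Summable (fun p : Σ k : ℕ, (Fin k → J) => ‖∏ i, u (p.2 i)‖) := by
    rw [summable_sigma_of_nonneg fun _ => norm_nonneg _]
    refine ⟨fun k => Summable.of_finite, ?_⟩
    simp only [tsum_fintype, norm_prod, ← Fintype.sum_pow (fun j => ‖u j‖)]
    exact summable_geometric_of_lt_one (Finset.sum_nonneg fun _ _ => norm_nonneg _) h
  refine ⟨hs, ?_⟩
  have h1 := hs.of_norm.hasSum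
  rw [hs.of_norm.tsum_sigma] at h1
  simp only [tsum_fintype, ← Fintype.sum_pow u] at h1
  rwa [tsum_geometric_of_norm_lt_one (lt_of_le_of_lt (norm_sum_le _ _) h)] at h1

/-- The exponential sum with frequency set `B` and coefficients `q`. -/
noncomputable def expSum (B : Finset ℝ) (q : ℝ → ℂ) (z : ℂ) : ℂ :=
  ∑ β ∈ B, q β * Complex.exp (2 * Real.pi * Complex.I * β * z)

theorem norm_exp_freq (β : ℝ) (z : ℂ) :
    ‖Complex.exp (2 * Real.pi * Complex.I * β * z)‖ = Real.exp (-(2 * Real.pi * β) * z.im) := by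
  rw [Complex.norm_exp]
  congr 1
  simp

/-- Equal frequencies are merged and cancelled ones dropped, so that the lowest remaining frequency
carries a nonzero coefficient. -/
theorem exists_eq_expSum {ψ : ℂ → ℂ} (hψ : ψ ∈ ExpPoly) :
    ∃ (B : Finset ℝ) (q : ℝ → ℂ), (∀ β ∈ B, q β ≠ 0) ∧ ψ = expSum B q := by
  classical
  obtain ⟨l, α, b, h⟩ := hψ
  let q : ℝ → ℂ := fun β => ∑ j ∈ Finset.univ.filter (fun j => α j = β), b j
  refine ⟨(Finset.univ.image α).filter (fun β => q β ≠ 0), q, fun β hβ => (Finset.mem_filter.1 hβ).2,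
    ?_⟩
  funext z
  rw [h, expSum, Finset.sum_filter_of_ne (fun β _ hβ => left_ne_zero_of_mul hβ),
    ← Finset.sum_fiberwise_of_maps_to (t := Finset.univ.image α) (g := α)
      (fun j _ => Finset.mem_image_of_mem _ (Finset.mem_univ j))]
  refine Finset.sum_congr rfl fun β _ => ?_
  rw [Finset.sum_mul]
  exact Finset.sum_congr rfl fun j hj => by rw [(Finset.mem_filter.1 hj).2]

theorem differentiable_expSum (B : Finset ℝ) (q : ℝ → ℂ) : Differentiable ℂ (expSum B q) := by
  unfold expSum
  fun_prop

theorem ExpPoly.differentiable {ψ : ℂ → ℂ} (hψ : ψ ∈ ExpPoly) : Differentiable ℂ ψ := by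
  obtain ⟨B, q, -, rfl⟩ := exists_eq_expSum hψ
  exact differentiable_expSum B q

theorem ExpPoly.comp_neg {ψ : ℂ → ℂ} (hψ : ψ ∈ ExpPoly) : (fun z => ψ (-z)) ∈ ExpPoly := by
  obtain ⟨l, α, b, h⟩ := hψ
  refine ⟨l, fun j => -α j, b, fun z => ?_⟩
  simp only [h]
  refine Finset.sum_congr rfl fun j _ => ?_
  push_cast
  ring_nf

theorem exists_norm_expSum_le (B : Finset ℝ) (q : ℝ → ℂ) (H : ℝ) :
    ∃ M : ℝ, ∀ z : ℂ, |z.im| ≤ H → ‖expSum B q z‖ ≤ M := by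
  refine ⟨∑ β ∈ B, ‖q β‖ * Real.exp (2 * Real.pi * |β| * H), fun z hz => ?_⟩
  refine (norm_sum_le _ _).trans (Finset.sum_le_sum fun β _ => ?_)
  rw [norm_mul, norm_exp_freq]
  refine mul_le_mul_of_nonneg_left (Real.exp_le_exp.2 ?_) (norm_nonneg _)
  calc -(2 * Real.pi * β) * z.im ≤ |-(2 * Real.pi * β) * z.im| := le_abs_self _
    _ = 2 * Real.pi * |β| * |z.im| := by
      rw [abs_mul, abs_neg, abs_mul, abs_of_pos Real.two_pi_pos]
    _ ≤ _ := by gcongr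

/-- An exponential sum is its term of lowest frequency times `1 - ∑ u` with `u` small high up in the
upper half-plane. -/
theorem expSum_eq_mul_one_sub {B : Finset ℝ} {q : ℝ → ℂ} (hq : ∀ β ∈ B, q β ≠ 0)
    (hB : B.Nonempty) :
    ∃ (β₀ : ℝ) (J : Finset ℝ) (H₀ : ℝ), q β₀ ≠ 0 ∧ (∀ j ∈ J, β₀ < j) ∧
      ∀ z : ℂ, expSum B q z = q β₀ * Complex.exp (2 * Real.pi * Complex.I * β₀ * z) *
        (1 - ∑ j : J, -(q j / q β₀) * Complex.exp (2 * Real.pi * Complex.I * (j - β₀ : ℝ) * z)) ∧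
      (H₀ ≤ z.im →
        ∑ j : J, ‖-(q j / q β₀) * Complex.exp (2 * Real.pi * Complex.I * (j - β₀ : ℝ) * z)‖ < 1) := by
  classical
  -- `|exp (2πiβz)| = exp (-2πβ Im z)`, so the lowest frequency dominates as `Im z → ∞` and all
  -- ratios to it tend to zero.
  set β₀ := B.min' hB with hβ₀
  have h0 : β₀ ∈ B := B.min'_mem hB
  have hJ : ∀ j ∈ B.erase β₀, β₀ < j := fun j hj =>
    lt_of_le_of_ne (B.min'_le j (Finset.mem_of_mem_erase hj)) (Finset.ne_of_mem_erase hj).symm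
  have hlim : Filter.Tendsto (fun H : ℝ => ∑ j : ↥(B.erase β₀),
      ‖q j / q β₀‖ * Real.exp (-(2 * Real.pi * (j - β₀)) * H)) Filter.atTop (nhds 0) := by
    have h1 : (0 : ℝ) = ∑ _j : ↥(B.erase β₀), 0 := by simp
    rw [h1]
    refine tendsto_finsetSum _ fun j _ => ?_
    rw [← mul_zero ‖q j / q β₀‖]
    refine Filter.Tendsto.const_mul _ (Real.tendsto_exp_atBot.comp ?_)
    have : 0 < 2 * Real.pi * ((j : ℝ) - β₀) :=
      mul_pos Real.two_pi_pos (sub_pos.2 (hJ j j.2))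
    exact Filter.Tendsto.const_mul_atTop_of_neg (by linarith) Filter.tendsto_id
  obtain ⟨H₀, hH₀⟩ := Filter.eventually_atTop.1 (hlim.eventually (gt_mem_nhds zero_lt_one))
  refine ⟨β₀, B.erase β₀, H₀, hq _ h0, hJ, fun z => ⟨?_, fun hz => ?_⟩⟩
  · rw [expSum, ← Finset.add_sum_erase B _ h0, mul_sub, mul_one, sub_eq_add_neg, Finset.mul_sum,
      ← Finset.sum_neg_distrib, ← Finset.sum_coe_sort (B.erase β₀)]
    congr 1
    refine Finset.sum_congr rfl fun j _ => ?_
    have h1 : Complex.exp (2 * Real.pi * Complex.I * j * z) =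
        Complex.exp (2 * Real.pi * Complex.I * β₀ * z) *
          Complex.exp (2 * Real.pi * Complex.I * (j - β₀ : ℝ) * z) := by
      rw [← Complex.exp_add]
      congr 1
      push_cast
      ring
    rw [h1]
    field_simp [hq _ h0]
  · refine lt_of_eq_of_lt (Finset.sum_congr rfl fun j _ => ?_) (hH₀ z.im hz)
    rw [norm_mul, norm_neg, norm_exp_freq]

theorem exists_expSum_ne_zero {B : Finset ℝ} {q : ℝ → ℂ} (hq : ∀ β ∈ B, q β ≠ 0)
    (hB : B.Nonempty) : ∃ H₀ : ℝ, ∀ z : ℂ, H₀ ≤ z.im → expSum B q z ≠ 0 := by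
  obtain ⟨β₀, J, H₀, h0, -, h⟩ := expSum_eq_mul_one_sub hq hB
  refine ⟨H₀, fun z hz => ?_⟩
  rw [(h z).1]
  refine mul_ne_zero (mul_ne_zero h0 (Complex.exp_ne_zero _)) fun h1 => ?_
  have h3 := lt_of_le_of_lt (norm_sum_le _ _) ((h z).2 hz)
  rw [← sub_eq_zero.1 h1] at h3
  simp at h3

/-- Quotients of exponential polynomials are sums of absolutely convergent exponential series high
up in the upper half-plane. -/
theorem exists_expansion_upper {ψ φ : ℂ → ℂ} (hψ : ψ ∈ ExpPoly) (hφ : φ ∈ ExpPoly)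
    (hne : ∃ z, φ z ≠ 0) :
    ∃ (ι : Type) (_ : Countable ι) (c : ι → ℂ) (σ : ι → ℝ) (H₀ : ℝ),
      HasPolynomialCount (Set.range σ) ∧ ∀ z : ℂ, H₀ ≤ z.im → φ z ≠ 0 ∧
        Summable (fun i => ‖c i * Complex.exp (2 * Real.pi * Complex.I * σ i * z)‖) ∧
        HasSum (fun i => c i * Complex.exp (2 * Real.pi * Complex.I * σ i * z)) (ψ z / φ z) := by
  obtain ⟨A, p, -, rfl⟩ := exists_eq_expSum hψ
  obtain ⟨B, q, hq, rfl⟩ := exists_eq_expSum hφ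
  have hB : B.Nonempty := by
    rw [Finset.nonempty_iff_ne_empty]
    rintro rfl
    obtain ⟨z, hz⟩ := hne
    simp [expSum] at hz
  obtain ⟨H₁, hH₁⟩ := exists_expSum_ne_zero hq hB
  obtain ⟨β₀, J, H₀, h0, hJ, h⟩ := expSum_eq_mul_one_sub hq hB
  -- An index is a frequency of `ψ` together with a word from the geometric series of `1 / φ`; the
  -- letters are the positive gaps `j - β₀`.
  refine ⟨A × (Σ k : ℕ, (Fin k → J)), inferInstance,
    fun i => p i.1 * ((q β₀)⁻¹ * ∏ l, -(q (i.2.2 l) / q β₀)),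
    fun i => ((i.1 : ℝ) - β₀) + ∑ l, ((i.2.2 l : ℝ) - β₀), max H₀ H₁,
    hasPolynomialCount_range_words (fun i : A => (i : ℝ) - β₀) (fun j : J => (j : ℝ) - β₀)
      (fun j => sub_pos.2 (hJ j j.2)), fun z hz => ⟨hH₁ z ((le_max_right _ _).trans hz), ?_⟩⟩
  obtain ⟨h1, h2⟩ := hasSum_words _ ((h z).2 ((le_max_left _ _).trans hz))
  set E : ℝ → ℂ := fun β => Complex.exp (2 * Real.pi * Complex.I * β * z) with hE
  have hterm : ∀ i : A × (Σ k : ℕ, (Fin k → J)),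
      p i.1 * ((q β₀)⁻¹ * ∏ l, -(q (i.2.2 l) / q β₀)) *
        Complex.exp (2 * Real.pi * Complex.I *
          ((((i.1 : ℝ) - β₀) + ∑ l, ((i.2.2 l : ℝ) - β₀) : ℝ) : ℂ) * z) =
      (p i.1 * E i.1) * ((q β₀ * E β₀)⁻¹ *
        ∏ l, (-(q (i.2.2 l) / q β₀) *
          Complex.exp (2 * Real.pi * Complex.I * ((i.2.2 l : ℝ) - β₀ : ℝ) * z))) := by
    intro i
    have h3 : Complex.exp (2 * Real.pi * Complex.I *
          ((((i.1 : ℝ) - β₀) + ∑ l, ((i.2.2 l : ℝ) - β₀) : ℝ) : ℂ) * z) =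
        E i.1 * (E β₀)⁻¹ *
          ∏ l, Complex.exp (2 * Real.pi * Complex.I * ((i.2.2 l : ℝ) - β₀ : ℝ) * z) := by
      rw [← Complex.exp_sum, ← Complex.exp_neg, ← Complex.exp_add, ← Complex.exp_add]
      congr 1
      push_cast
      rw [← Finset.sum_mul, ← Finset.mul_sum]
      ring
    rw [h3, Finset.prod_mul_distrib, mul_inv]
    ring
  simp only [hterm]
  have h4 : Summable (fun i : A => ‖p i * E i‖) := Summable.of_finite
  have h5 : Summable (fun w : (Σ k : ℕ, (Fin k → J)) => ‖(q β₀ * E β₀)⁻¹ *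
        ∏ l, (-(q (w.2 l) / q β₀) *
          Complex.exp (2 * Real.pi * Complex.I * ((w.2 l : ℝ) - β₀ : ℝ) * z))‖) := by
    simp only [norm_mul _ (∏ _, _)]
    exact h1.mul_left _
  have h6 := h4.mul_norm h5
  refine ⟨h6, ?_⟩
  have h7 := (hasSum_fintype (fun i : A => p i * E i)).mul (h2.mul_left (q β₀ * E β₀)⁻¹) h6.of_norm
  convert! h7 using 1
  rw [(h z).1, div_eq_mul_inv, mul_inv, expSum, Finset.sum_coe_sort A (fun i => p i * E i)]

end ExpSum

/-! ### Uniform lower bounds by compactness -/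

section LowerBounds

/-- Countability is what leaves a radius or an abscissa that avoids every zero. -/
theorem countable_zeros {f : ℂ → ℂ} (hf : Differentiable ℂ f) (hne : ∃ z, f z ≠ 0) :
    {z | f z = 0}.Countable := by
  obtain ⟨w, hw⟩ := hne
  have h := AnalyticOnNhd.preimage_zero_mem_codiscrete
    (hf.differentiableOn.analyticOnNhd isOpen_univ) hw
  have h1 : {z | f z = 0} = (f ⁻¹' {0}ᶜ)ᶜ := by ext; simp
  rw [h1]
  exact (HereditarilyLindelofSpace.isLindelof _).countable_of_isDiscrete (mem_codiscrete'.1 h).2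

/-- A continuous family of functions over a compact space, each of which has no zero on some member
of a family of compact sets, is uniformly bounded below on such members. -/
theorem exists_uniform_lower_bound {P X I : Type*} [TopologicalSpace P] [CompactSpace P]
    [TopologicalSpace X] {F : P × X → ℂ} (hF : Continuous F) {K : I → Set X}
    (hK : ∀ i, IsCompact (K i)) (h : ∀ p, ∃ i, ∀ x ∈ K i, F (p, x) ≠ 0) :
    ∃ η : ℝ, 0 < η ∧ ∀ p, ∃ i, ∀ x ∈ K i, η ≤ ‖F (p, x)‖ := by
  -- The `U n` increase, cover `P` by compactness of the `K i`, and are open by the tube lemma;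
  -- compactness of `P` then makes one of them everything.
  let U : ℕ → Set P := fun n => {p | ∃ i, ∀ x ∈ K i, 1 / ((n : ℝ) + 1) < ‖F (p, x)‖}
  have hU : ∀ n, IsOpen (U n) := by
    intro n
    rw [isOpen_iff_mem_nhds]
    rintro p ⟨i, hi⟩
    have h1 := (hK i).eventually_forall_of_forall_eventually (x₀ := p)
      (P := fun p x => 1 / ((n : ℝ) + 1) < ‖F (p, x)‖)
      (fun x hx => (hF.norm.continuousAt).eventually (lt_mem_nhds (hi x hx)))
    filter_upwards [h1] with p' hp'
    exact ⟨i, hp'⟩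
  have hcover : (Set.univ : Set P) ⊆ ⋃ n, U n := by
    intro p _
    obtain ⟨i, hi⟩ := h p
    have hcont : Continuous fun x => ‖F (p, x)‖ := by fun_prop
    rcases (K i).eq_empty_or_nonempty with hem | hn
    · exact Set.mem_iUnion.2 ⟨0, i, by simp [hem]⟩
    · obtain ⟨x, hx, hmin⟩ := (hK i).exists_isMinOn hn hcont.continuousOn
      obtain ⟨n, hn⟩ := exists_nat_one_div_lt (norm_pos_iff.2 (hi x hx))
      exact Set.mem_iUnion.2 ⟨n, i, fun y hy => hn.trans_le (hmin hy)⟩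
  have hmono : Monotone U := by
    rintro m n hmn p ⟨i, hi⟩
    refine ⟨i, fun x hx => lt_of_le_of_lt ?_ (hi x hx)⟩
    exact one_div_le_one_div_of_le (by positivity) (by gcongr)
  obtain ⟨n, hn⟩ := isCompact_univ.elim_directed_cover U hU hcover hmono.directed_le
  refine ⟨1 / ((n : ℝ) + 1), by positivity, fun p => ?_⟩
  obtain ⟨i, hi⟩ := hn (Set.mem_univ p)
  exact ⟨i, fun x hx => (hi x hx).le⟩

/-- Real translation acts by unimodular factors on the coefficients, which embeds all translates in
a family over the compact space `ℝ → Circle`. -/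
theorem expSum_add_ofReal (B : Finset ℝ) (q : ℝ → ℂ) (x : ℝ) (z : ℂ) :
    expSum B q (x + z) = expSum B (fun β => q β * Circle.exp (2 * Real.pi * β * x)) z := by
  refine Finset.sum_congr rfl fun β _ => ?_
  change _ = q β * (Circle.exp (2 * Real.pi * β * x) : ℂ) * _
  rw [Circle.coe_exp, mul_assoc (q β), ← Complex.exp_add]
  congr 2
  push_cast
  ring

theorem exists_twisted_expSum_ne_zero {B : Finset ℝ} {q : ℝ → ℂ} (hq : ∀ β ∈ B, q β ≠ 0)
    (hB : B.Nonempty) (θ : ℝ → Circle) : ∃ z, expSum B (fun β => q β * θ β) z ≠ 0 := by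
  obtain ⟨H, h⟩ := exists_expSum_ne_zero (B := B) (q := fun β => q β * θ β)
    (fun β hβ => mul_ne_zero (hq β hβ) (Circle.coe_ne_zero _)) hB
  exact ⟨H * Complex.I, h _ (by simp)⟩

theorem continuous_twisted_expSum (B : Finset ℝ) (q : ℝ → ℂ) :
    Continuous fun p : (ℝ → Circle) × ℂ => expSum B (fun β => q β * p.1 β) p.2 := by
  unfold expSum
  fun_prop

theorem ExpPoly.exists_nonempty_expSum {φ : ℂ → ℂ} (hφ : φ ∈ ExpPoly) (hne : ∃ z, φ z ≠ 0) :
    ∃ (B : Finset ℝ) (q : ℝ → ℂ), B.Nonempty ∧ (∀ β ∈ B, q β ≠ 0) ∧ φ = expSum B q := by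
  obtain ⟨B, q, hq, rfl⟩ := exists_eq_expSum hφ
  refine ⟨B, q, ?_, hq, rfl⟩
  rw [Finset.nonempty_iff_ne_empty]
  rintro rfl
  obtain ⟨z, hz⟩ := hne
  simp [expSum] at hz

/-- Around each point of a strip there is a small circle on which an exponential polynomial is
bounded below, uniformly in the point. -/
theorem ExpPoly.exists_circle_lower_bound {φ : ℂ → ℂ} (hφ : φ ∈ ExpPoly) (hne : ∃ z, φ z ≠ 0)
    {ρ : ℝ} (hρ : 0 < ρ) (H : ℝ) :
    ∃ η : ℝ, 0 < η ∧ ∀ w : ℂ, |w.im| ≤ H → ∃ r ∈ Set.Ioo 0 ρ, ∀ z ∈ Metric.sphere w r,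
      η ≤ ‖φ z‖ := by
  obtain ⟨B, q, hB, hq, rfl⟩ := ExpPoly.exists_nonempty_expSum hφ hne
  -- The parameters are the rotation `θ`, standing for the real part of the centre, and its height;
  -- every circle is thereby recentred at `0`.
  let F : ((ℝ → Circle) × Set.Icc (-H) H) × ℂ → ℂ := fun p =>
    expSum B (fun β => q β * p.1.1 β) (p.2 + (p.1.2 : ℝ) * Complex.I)
  have hF : Continuous F :=
    (continuous_twisted_expSum B q).comp (f := fun p : ((ℝ → Circle) × Set.Icc (-H) H) × ℂ =>
      (p.1.1, p.2 + ((p.1.2 : ℝ) : ℂ) * Complex.I)) (by fun_prop)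
  obtain ⟨η, hη, h⟩ := exists_uniform_lower_bound hF
    (K := fun r : Set.Ioo 0 ρ => Metric.sphere (0 : ℂ) r) (fun r => isCompact_sphere _ _) (by
      rintro ⟨θ, y⟩
      obtain ⟨z₀, hz₀⟩ := exists_twisted_expSum_ne_zero hq hB θ
      have hd : Differentiable ℂ fun z => F ((θ, y), z) := by
        simp only [F, expSum]
        fun_prop
      have hc := countable_zeros hd
        ⟨z₀ - (y : ℝ) * Complex.I, by simpa [F] using hz₀⟩
      obtain ⟨r, hr, hr'⟩ := ((hc.image norm).dense_compl ℝ).exists_between hρ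
      refine ⟨⟨r, hr'⟩, fun z hz h0 => hr ⟨z, h0, ?_⟩⟩
      simpa using hz)
  refine ⟨η, hη, fun w hw => ?_⟩
  obtain ⟨⟨r, hr⟩, h'⟩ := h (fun β => Circle.exp (2 * Real.pi * β * w.re),
    ⟨w.im, abs_le.1 hw⟩)
  refine ⟨r, hr, fun z hz => ?_⟩
  have h2 := h' (z - w) (by simpa [dist_eq_norm] using hz)
  have h3 : expSum B q z = F ((fun β => Circle.exp (2 * Real.pi * β * w.re),
      ⟨w.im, abs_le.1 hw⟩), z - w) := by
    simp only [F]
    rw [← expSum_add_ofReal]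
    congr 1
    nth_rewrite 2 [← Complex.re_add_im w]
    ring
  rwa [h3]

/-- Every unit interval contains the abscissa of a vertical segment on which an exponential
polynomial is bounded below, uniformly in the interval. -/
theorem ExpPoly.exists_vertical_lower_bound {φ : ℂ → ℂ} (hφ : φ ∈ ExpPoly) (hne : ∃ z, φ z ≠ 0)
    (H : ℝ) :
    ∃ η : ℝ, 0 < η ∧ ∀ x : ℝ, ∃ T ∈ Set.Ioo x (x + 1), ∀ y : ℝ, |y| ≤ H →
      η ≤ ‖φ (T + y * Complex.I)‖ := by
  obtain ⟨B, q, hB, hq, rfl⟩ := ExpPoly.exists_nonempty_expSum hφ hne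
  obtain ⟨η, hη, h⟩ := exists_uniform_lower_bound (continuous_twisted_expSum B q)
    (K := fun T : Set.Ioo (0 : ℝ) 1 => (fun y : ℝ => (T : ℂ) + y * Complex.I) '' Set.Icc (-H) H)
    (fun r => isCompact_Icc.image (by fun_prop)) (by
      intro θ
      have hc := countable_zeros (differentiable_expSum B _)
        (exists_twisted_expSum_ne_zero hq hB θ)
      -- The real parts of the zeros are countable, so some abscissa in `(0, 1)` misses them all.
      obtain ⟨T, hT, hT'⟩ := ((hc.image Complex.re).dense_compl ℝ).exists_between one_pos
      refine ⟨⟨T, hT'⟩, ?_⟩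
      rintro _ ⟨y, -, rfl⟩ h0
      exact hT ⟨_, h0, by simp⟩)
  refine ⟨η, hη, fun x => ?_⟩
  obtain ⟨⟨T, hT⟩, h'⟩ := h (fun β => Circle.exp (2 * Real.pi * β * x))
  refine ⟨x + T, ⟨by linarith [hT.1], by linarith [hT.2]⟩, fun y hy => ?_⟩
  have h2 := h' _ ⟨y, abs_le.1 hy, rfl⟩
  rw [← expSum_add_ofReal] at h2
  push_cast
  rwa [add_assoc]

/-- Minimum modulus principle for the quotient of a function by its only zero in a disc. -/
theorem le_norm_deriv_of_le_sphere {f : ℂ → ℂ} (hf : Differentiable ℂ f) {w : ℂ} {r η : ℝ}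
    (hr : 0 < r) (hη : 0 < η) (hw : f w = 0) (hw' : deriv f w ≠ 0)
    (hball : ∀ z ∈ Metric.closedBall w r, f z = 0 → z = w)
    (hs : ∀ z ∈ Metric.sphere w r, η ≤ ‖f z‖) : η / r ≤ ‖deriv f w‖ := by
  have hd : Differentiable ℂ (dslope f w) := by
    rw [← differentiableOn_univ] at hf ⊢
    exact (Complex.differentiableOn_dslope Filter.univ_mem).2 hf
  have hne : ∀ z ∈ Metric.closedBall w r, dslope f w z ≠ 0 := by
    intro z hz
    by_cases h : z = w
    · rw [h, dslope_same]; exact hw'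
    · rw [dslope_of_ne _ h, slope_def_field, hw, sub_zero]
      exact div_ne_zero (fun h0 => h (hball z hz h0)) (sub_ne_zero.2 h)
  -- Maximum principle for `(z - w) / f z`, which is holomorphic because `w` is the only zero and
  -- simple; on the circle its modulus is at most `r / η`.
  have h1 : ‖(dslope f w w)⁻¹‖ ≤ r / η := by
    refine Complex.norm_le_of_forall_mem_frontier_norm_le (f := fun z => (dslope f w z)⁻¹)
      (U := Metric.ball w r) Metric.isBounded_ball ⟨?_, ?_⟩ ?_
      (subset_closure (Metric.mem_ball_self hr))
    · exact fun z hz =>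
        ((hd z).inv (hne z (Metric.ball_subset_closedBall hz))).differentiableWithinAt
    · rw [closure_ball w hr.ne']
      exact hd.continuous.continuousOn.inv₀ hne
    · intro z hz
      rw [frontier_ball w hr.ne'] at hz
      have hzw : z ≠ w := by
        rintro rfl
        simp [hr.ne] at hz
      rw [norm_inv, dslope_of_ne _ hzw, slope_def_field, hw, sub_zero, norm_div,
        mem_sphere_iff_norm.1 hz, inv_div]
      gcongr
      exact hs z hz
  rw [dslope_same, norm_inv] at h1
  have h2 : 0 < ‖deriv f w‖ := norm_pos_iff.2 hw'
  rw [inv_le_comm₀ h2 (by positivity), inv_div] at h1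
  exact h1

/-- The derivatives of an exponential polynomial at its zeros are bounded below. -/
theorem ExpPolySimple.exists_le_norm_deriv {φ : ℂ → ℂ} (hφ : φ ∈ ExpPolySimple)
    (hne : ∃ z, φ z ≠ 0) (H : ℝ) :
    ∃ κ : ℝ, 0 < κ ∧ ∀ w ∈ zeroSet φ, |w.im| ≤ H → κ ≤ ‖deriv φ w‖ := by
  obtain ⟨hE, hsimple, δ, hδ, hsep⟩ := hφ
  -- Radii below the separation `δ` leave each zero alone in its disc.
  obtain ⟨η, hη, h⟩ := ExpPoly.exists_circle_lower_bound hE hne hδ H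
  refine ⟨η / δ, by positivity, fun w hw hwH => ?_⟩
  obtain ⟨r, hr, h'⟩ := h w hwH
  have := le_norm_deriv_of_le_sphere (ExpPoly.differentiable hE) hr.1 hη hw (hsimple w hw)
    (fun z hz h0 => by
      by_contra hzw
      have h1 := hsep z h0 w hw hzw
      have h2 := mem_closedBall_iff_norm.1 hz
      linarith [hr.2]) h'
  refine le_trans ?_ this
  exact div_le_div_of_nonneg_left hη.le hr.1 hr.2.le

end LowerBounds

/-! ### The residue theorem on rectangles -/

section Rectangle

/-- The integral over the boundary of the rectangle `[a, b] × [c, d]`, counterclockwise. -/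
noncomputable def rectIntegral (F : ℂ → ℂ) (a b c d : ℝ) : ℂ :=
  (∫ x : ℝ in a..b, F (x + c * Complex.I)) - (∫ x : ℝ in a..b, F (x + d * Complex.I)) +
    Complex.I • (∫ y : ℝ in c..d, F (b + y * Complex.I)) -
    Complex.I • (∫ y : ℝ in c..d, F (a + y * Complex.I))

def rectBoundary (a b c d : ℝ) : Set ℂ :=
  {z | (z.re ∈ Set.Icc a b ∧ (z.im = c ∨ z.im = d)) ∨ ((z.re = a ∨ z.re = b) ∧ z.im ∈ Set.Icc c d)}

theorem intervalIntegrable_of_continuousOn_rectBoundary {F : ℂ → ℂ} {a b c d : ℝ} (hab : a ≤ b)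
    (hcd : c ≤ d) (hF : ContinuousOn F (rectBoundary a b c d)) :
    (IntervalIntegrable (fun x : ℝ => F (x + c * Complex.I)) MeasureTheory.volume a b ∧
      IntervalIntegrable (fun x : ℝ => F (x + d * Complex.I)) MeasureTheory.volume a b) ∧
    (IntervalIntegrable (fun y : ℝ => F (b + y * Complex.I)) MeasureTheory.volume c d ∧
      IntervalIntegrable (fun y : ℝ => F (a + y * Complex.I)) MeasureTheory.volume c d) := by
  refine ⟨⟨?_, ?_⟩, ?_, ?_⟩ <;> refine ContinuousOn.intervalIntegrable_of_Icc ‹_› ?_ <;>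
    refine hF.comp (by fun_prop) fun x hx => ?_ <;> simp [rectBoundary] at hx ⊢ <;> grind

theorem rectIntegral_congr {F G : ℂ → ℂ} {a b c d : ℝ} (hab : a ≤ b) (hcd : c ≤ d)
    (h : Set.EqOn F G (rectBoundary a b c d)) :
    rectIntegral F a b c d = rectIntegral G a b c d := by
  unfold rectIntegral
  refine congrArg₂ _ (congrArg₂ _ (congrArg₂ _ ?_ ?_) (congrArg _ ?_)) (congrArg _ ?_)
  all_goals
    refine intervalIntegral.integral_congr fun x hx => h ?_
    rw [Set.uIcc_of_le ‹_›] at hx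
    simp [rectBoundary] at hx ⊢
    grind

theorem rectIntegral_add {F G : ℂ → ℂ} {a b c d : ℝ} (hab : a ≤ b) (hcd : c ≤ d)
    (hF : ContinuousOn F (rectBoundary a b c d)) (hG : ContinuousOn G (rectBoundary a b c d)) :
    rectIntegral (fun z => F z + G z) a b c d =
      rectIntegral F a b c d + rectIntegral G a b c d := by
  obtain ⟨⟨h1, h2⟩, h3, h4⟩ := intervalIntegrable_of_continuousOn_rectBoundary hab hcd hF
  obtain ⟨⟨k1, k2⟩, k3, k4⟩ := intervalIntegrable_of_continuousOn_rectBoundary hab hcd hG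
  unfold rectIntegral
  rw [intervalIntegral.integral_add h1 k1, intervalIntegral.integral_add h2 k2,
    intervalIntegral.integral_add h3 k3, intervalIntegral.integral_add h4 k4]
  simp only [smul_eq_mul]
  ring

theorem rectIntegral_const_mul (F : ℂ → ℂ) (k : ℂ) (a b c d : ℝ) :
    rectIntegral (fun z => k * F z) a b c d = k * rectIntegral F a b c d := by
  unfold rectIntegral
  simp only [intervalIntegral.integral_const_mul, smul_eq_mul]
  ring

theorem rectIntegral_sum {ι : Type*} (s : Finset ι) (F : ι → ℂ → ℂ) {a b c d : ℝ} (hab : a ≤ b)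
    (hcd : c ≤ d) (hF : ∀ i ∈ s, ContinuousOn (F i) (rectBoundary a b c d)) :
    rectIntegral (fun z => ∑ i ∈ s, F i z) a b c d = ∑ i ∈ s, rectIntegral (F i) a b c d := by
  classical
  induction s using Finset.induction_on with
  | empty => simp [rectIntegral]
  | insert i s hi ih =>
    simp only [Finset.sum_insert hi]
    rw [rectIntegral_add hab hcd (hF i (Finset.mem_insert_self _ _)),
      ih fun j hj => hF j (Finset.mem_insert_of_mem hj)]
    exact continuousOn_finsetSum _ fun j hj => hF j (Finset.mem_insert_of_mem hj)

theorem rectIntegral_eq_zero {F : ℂ → ℂ} {a b c d : ℝ}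
    (hF : DifferentiableOn ℂ F (Set.uIcc a b ×ℂ Set.uIcc c d)) : rectIntegral F a b c d = 0 := by
  have h := Complex.integral_boundary_rect_eq_zero_of_differentiableOn F (a + c * Complex.I)
    (b + d * Complex.I) (by simpa using hF)
  simpa [rectIntegral] using h

theorem log_sub_log_neg_of_im_pos {z : ℂ} (hz : 0 < z.im) :
    Complex.log z - Complex.log (-z) = Real.pi * Complex.I := by
  simp only [Complex.log, norm_neg, Complex.arg_neg_eq_arg_sub_pi_of_im_pos hz]
  push_cast
  ring

theorem log_sub_log_neg_of_im_neg {z : ℂ} (hz : z.im < 0) :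
    Complex.log z - Complex.log (-z) = -(Real.pi * Complex.I) := by
  simp only [Complex.log, norm_neg, Complex.arg_neg_eq_arg_add_pi_of_im_neg hz]
  push_cast
  ring

/-- `log (z - w)` is a primitive on three sides; the left side crosses its cut, so `log (-(z - w))`
is used there. The two primitives differ by `πi` at the upper left corner and `-πi` at the lower,
which leaves `2πi`. -/
theorem rectIntegral_sub_inv {a b c d : ℝ} {w : ℂ} (ha : a < w.re) (hb : w.re < b) (hc : c < w.im)
    (hd : w.im < d) : rectIntegral (fun z => (z - w)⁻¹) a b c d = 2 * Real.pi * Complex.I := by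
  have hor : ∀ t : ℝ, t ≠ w.im → ∫ x : ℝ in a..b, ((x : ℂ) + t * Complex.I - w)⁻¹ =
      Complex.log (b + t * Complex.I - w) - Complex.log (a + t * Complex.I - w) := by
    intro t ht
    have hs : ∀ x : ℝ, (x : ℂ) + t * Complex.I - w ∈ Complex.slitPlane := fun x =>
      Complex.mem_slitPlane_iff.2 (Or.inr (by simpa [sub_eq_zero] using ht))
    refine intervalIntegral.integral_eq_sub_of_hasDerivAt
      (f := fun x : ℝ => Complex.log (x + t * Complex.I - w)) (fun x _ => ?_) ?_
    · have h1 : HasDerivAt (fun z : ℂ => z + t * Complex.I - w) 1 (x : ℂ) :=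
        ((hasDerivAt_id _).add_const _).sub_const _
      simpa using (h1.clog (hs x)).comp_ofReal
    · refine (Continuous.inv₀ (by fun_prop) fun x => ?_).intervalIntegrable _ _
      exact Complex.slitPlane_ne_zero (hs x)
  have hder : ∀ s y : ℝ, HasDerivAt (fun y : ℝ => (s : ℂ) + y * Complex.I - w) Complex.I y := by
    intro s y
    have h1 : HasDerivAt (fun z : ℂ => (s : ℂ) + z * Complex.I - w) Complex.I (y : ℂ) := by
      simpa using (((hasDerivAt_id (y : ℂ)).mul_const Complex.I).const_add (s : ℂ)).sub_const w
    exact h1.comp_ofReal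
  have hright : Complex.I • (∫ y : ℝ in c..d, ((b : ℂ) + y * Complex.I - w)⁻¹) =
      Complex.log (b + d * Complex.I - w) - Complex.log (b + c * Complex.I - w) := by
    have hs : ∀ y : ℝ, (b : ℂ) + y * Complex.I - w ∈ Complex.slitPlane := fun x =>
      Complex.mem_slitPlane_iff.2 (Or.inl (by simpa using hb))
    rw [smul_eq_mul, ← intervalIntegral.integral_const_mul]
    refine intervalIntegral.integral_eq_sub_of_hasDerivAt
      (f := fun y : ℝ => Complex.log (b + y * Complex.I - w)) (fun y _ => ?_) ?_
    · simpa [div_eq_mul_inv] using (hder b y).clog_real (hs y)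
    · refine (Continuous.mul continuous_const
        (Continuous.inv₀ (by fun_prop) fun x => ?_)).intervalIntegrable _ _
      exact Complex.slitPlane_ne_zero (hs x)
  have hleft : Complex.I • (∫ y : ℝ in c..d, ((a : ℂ) + y * Complex.I - w)⁻¹) =
      Complex.log (-(a + d * Complex.I - w)) - Complex.log (-(a + c * Complex.I - w)) := by
    have hs : ∀ y : ℝ, -((a : ℂ) + y * Complex.I - w) ∈ Complex.slitPlane := fun x =>
      Complex.mem_slitPlane_iff.2 (Or.inl (by simpa using ha))
    rw [smul_eq_mul, ← intervalIntegral.integral_const_mul]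
    refine intervalIntegral.integral_eq_sub_of_hasDerivAt
      (f := fun y : ℝ => Complex.log (-(a + y * Complex.I - w))) (fun y _ => ?_) ?_
    · convert! (hder a y).neg.clog_real (hs y) using 1
      rw [Pi.neg_apply, neg_div_neg_eq, div_eq_mul_inv]
    · refine (Continuous.mul continuous_const
        (Continuous.inv₀ (by fun_prop) fun x => ?_)).intervalIntegrable _ _
      exact neg_ne_zero.1 (Complex.slitPlane_ne_zero (hs x))
  unfold rectIntegral
  rw [hright, hleft, hor c hc.ne, hor d hd.ne']
  have h1 := log_sub_log_neg_of_im_pos (z := a + d * Complex.I - w) (by simpa using hd)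
  have h2 := log_sub_log_neg_of_im_neg (z := a + c * Complex.I - w) (by simpa using hc)
  linear_combination h1 - h2

/-- A quotient of functions of which the denominator has a simple zero, and the numerator a zero,
has a removable singularity. -/
theorem differentiableAt_div_of_simple_zero {D φ : ℂ → ℂ} (hD : Differentiable ℂ D)
    (hφ : Differentiable ℂ φ) {w : ℂ} (h0 : φ w = 0) (hD0 : D w = 0) (h1 : deriv φ w ≠ 0) :
    DifferentiableAt ℂ (fun z => if φ z = 0 then deriv D z / deriv φ z else D z / φ z) w := by
  have hd : ∀ {f : ℂ → ℂ}, Differentiable ℂ f → Differentiable ℂ (dslope f w) := by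
    intro f hf
    rw [← differentiableOn_univ] at hf ⊢
    exact (Complex.differentiableOn_dslope Filter.univ_mem).2 hf
  have hne : dslope φ w w ≠ 0 := by rwa [dslope_same]
  have hev : (fun z => if φ z = 0 then deriv D z / deriv φ z else D z / φ z) =ᶠ[nhds w]
      fun z => dslope D w z / dslope φ w z := by
    filter_upwards [(hd hφ).continuous.continuousAt.eventually_ne hne] with z hz
    by_cases hzw : z = w
    · rw [hzw, if_pos h0, dslope_same, dslope_same]
    · have hsub : z - w ≠ 0 := sub_ne_zero.2 hzw
      rw [dslope_of_ne _ hzw, slope_def_field, h0, sub_zero] at hz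
      have hφz : φ z ≠ 0 := fun h => hz (by rw [h, zero_div])
      rw [if_neg hφz, dslope_of_ne _ hzw, dslope_of_ne _ hzw, slope_def_field, slope_def_field, h0,
        hD0, sub_zero, sub_zero]
      field_simp
  exact ((hd hD w).div (hd hφ w) hne).congr_of_eventuallyEq hev

/-- The residue theorem for a rectangle and a quotient of entire functions of which the denominator
has simple zeros. -/
theorem rectIntegral_div {N φ : ℂ → ℂ} (hN : Differentiable ℂ N) (hφ : Differentiable ℂ φ)
    {a b c d : ℝ} (hab : a ≤ b) (hcd : c ≤ d) (Z : Finset ℂ)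
    (hZ : ∀ w ∈ Z, φ w = 0 ∧ deriv φ w ≠ 0 ∧ w.re ∈ Set.Ioo a b ∧ w.im ∈ Set.Ioo c d)
    (hZ' : ∀ w : ℂ, w.re ∈ Set.Icc a b → w.im ∈ Set.Icc c d → φ w = 0 → w ∈ Z) :
    rectIntegral (fun z => N z / φ z) a b c d =
      2 * Real.pi * Complex.I * ∑ w ∈ Z, N w / deriv φ w := by
  classical
  -- On `Z`, `dslope φ w` is `φ'(w)` at `w` and zero at the other points, so `D` vanishes on `Z`.
  -- Dividing by `φ` splits the quotient into a part with removable singularities and `∑ res / (z -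
  -- w)`.
  let D : ℂ → ℂ := fun z => N z - ∑ w ∈ Z, N w / deriv φ w * dslope φ w z
  have hdφ : ∀ w, Differentiable ℂ (dslope φ w) := by
    intro w
    rw [← differentiableOn_univ] at hφ ⊢
    exact (Complex.differentiableOn_dslope Filter.univ_mem).2 hφ
  have hD : Differentiable ℂ D := by
    refine hN.sub (Differentiable.fun_sum fun w _ => (hdφ w).const_mul _)
  have hD0 : ∀ w ∈ Z, D w = 0 := by
    intro w hw
    simp only [D]
    rw [Finset.sum_eq_single_of_mem w hw, dslope_same, div_mul_cancel₀ _ (hZ w hw).2.1, sub_self]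
    intro v hv hvw
    rw [dslope_of_ne _ hvw.symm, slope_def_field, (hZ w hw).1, (hZ v hv).1]
    simp
  let h : ℂ → ℂ := fun z => if φ z = 0 then deriv D z / deriv φ z else D z / φ z
  have hh : DifferentiableOn ℂ h (Set.uIcc a b ×ℂ Set.uIcc c d) := by
    intro z hz
    rw [Set.uIcc_of_le hab, Set.uIcc_of_le hcd, Complex.mem_reProdIm] at hz
    refine DifferentiableAt.differentiableWithinAt ?_
    by_cases hz0 : φ z = 0
    · have hzZ := hZ' z hz.1 hz.2 hz0
      exact differentiableAt_div_of_simple_zero hD hφ hz0 (hD0 z hzZ) (hZ z hzZ).2.1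
    · have hev : h =ᶠ[nhds z] fun z => D z / φ z := by
        filter_upwards [hφ.continuous.continuousAt.eventually_ne hz0] with v hv
        exact if_neg hv
      exact ((hD z).div (hφ z) hz0).congr_of_eventuallyEq hev
  have hsubset : rectBoundary a b c d ⊆ Set.uIcc a b ×ℂ Set.uIcc c d := by
    intro z hz
    rw [Set.uIcc_of_le hab, Set.uIcc_of_le hcd, Complex.mem_reProdIm]
    simp only [rectBoundary, Set.mem_ofPred_eq, Set.mem_Icc] at hz ⊢
    grind
  have hnZ : ∀ z ∈ rectBoundary a b c d, z ∉ Z := by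
    intro z hz hzZ
    have h1 := (hZ z hzZ).2.2
    simp only [rectBoundary, Set.mem_ofPred_eq, Set.mem_Icc, Set.mem_Ioo] at hz h1
    grind
  have hφne : ∀ z ∈ rectBoundary a b c d, φ z ≠ 0 := by
    intro z hz h0
    have h1 := hsubset hz
    rw [Set.uIcc_of_le hab, Set.uIcc_of_le hcd, Complex.mem_reProdIm] at h1
    exact hnZ z hz (hZ' z h1.1 h1.2 h0)
  have hcont : ∀ w ∈ Z, ContinuousOn (fun z => N w / deriv φ w * (z - w)⁻¹)
      (rectBoundary a b c d) := fun w hw =>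
    continuousOn_const.mul (ContinuousOn.inv₀ (by fun_prop) fun z hz => sub_ne_zero.2 (by
      rintro rfl
      exact hnZ _ hz hw))
  have heq : Set.EqOn (fun z => N z / φ z)
      (fun z => h z + ∑ w ∈ Z, N w / deriv φ w * (z - w)⁻¹) (rectBoundary a b c d) := by
    intro z hz
    have hz0 := hφne z hz
    simp only [h, if_neg hz0, D]
    rw [sub_div, Finset.sum_div, sub_add, eq_comm, sub_eq_self, sub_eq_zero]
    refine Finset.sum_congr rfl fun w hw => ?_
    have hzw : z ≠ w := by
      rintro rfl
      exact hnZ _ hz hw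
    rw [dslope_of_ne _ hzw, slope_def_field, (hZ w hw).1, sub_zero]
    field_simp
  rw [rectIntegral_congr hab hcd heq, rectIntegral_add hab hcd (hh.continuousOn.mono hsubset)
    (continuousOn_finsetSum _ hcont), rectIntegral_eq_zero hh, zero_add,
    rectIntegral_sum _ _ hab hcd hcont, Finset.mul_sum]
  refine Finset.sum_congr rfl fun w hw => ?_
  obtain ⟨-, -, h1, h2⟩ := hZ w hw
  rw [rectIntegral_const_mul, rectIntegral_sub_inv h1.1 h1.2 h2.1 h2.2]
  ring

end Rectangle

/-! ### Sums over uniformly discrete sets and over frequencies -/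

section Sums

theorem summable_int_inv_one_add_sq : Summable fun n : ℤ => (1 + (n : ℝ) ^ 2)⁻¹ := by
  refine Summable.of_norm_bounded_eventually (Real.summable_one_div_int_pow.2 one_lt_two) ?_
  filter_upwards [(Set.finite_singleton (0 : ℤ)).compl_mem_cofinite] with n hn
  have hn0 : (n : ℝ) ≠ 0 := by simpa using hn
  rw [Real.norm_of_nonneg (by positivity), ← one_div]
  exact one_div_le_one_div_of_le (by positivity) (by linarith)

/-- Sums over a uniformly discrete set in a horizontal strip are bounded by sums over `ℤ`. -/
theorem UniformlyDiscrete.exists_tsum_le {Z : Set ℂ} (hZ : UniformlyDiscrete Z) {H : ℝ}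
    (hH : ∀ z ∈ Z, |z.im| ≤ H) :
    ∃ h K : ℝ, 0 < h ∧ 0 ≤ K ∧ ∀ (G : ℤ → ℝ) (g : Z → ℝ), (∀ n, 0 ≤ G n) → Summable G →
      (∀ w, 0 ≤ g w) → (∀ w : Z, g w ≤ G ⌊(w : ℂ).re / h⌋) →
        Summable g ∧ ∑' w, g w ≤ K * ∑' n, G n := by
  obtain ⟨δ, hδ, hsep⟩ := hZ
  obtain ⟨h, hh0, hh⟩ : ∃ h : ℝ, 0 < h ∧ h + h = δ := ⟨δ / 2, by positivity, by ring⟩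
  obtain ⟨M, hM⟩ : ∃ M : Finset ℤ, ∀ w : Z, ⌊(w : ℂ).im / h⌋ ∈ M := by
    refine ⟨Finset.Icc ⌊-H / h⌋ ⌊H / h⌋, fun w => ?_⟩
    obtain ⟨h1, h2⟩ := abs_le.1 (hH w w.2)
    exact Finset.mem_Icc.2 ⟨Int.floor_le_floor (by gcongr), Int.floor_le_floor (by gcongr)⟩
  refine ⟨h, M.card, hh0, by positivity, fun G g hG0 hG hg0 hg => ?_⟩
  -- Each square cell of side `h = δ / 2` holds at most one point, since two would be closer than `h
  -- + h = δ`; only finitely many rows meet the strip.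
  let κ : Z → ℤ × M := fun w => (⌊(w : ℂ).re / h⌋, ⟨⌊(w : ℂ).im / h⌋, hM w⟩)
  have hκ : Function.Injective κ := by
    intro z w hzw
    by_contra hne
    have h1 : ⌊(z : ℂ).re / h⌋ = ⌊(w : ℂ).re / h⌋ := congrArg Prod.fst hzw
    have h2 : ⌊(z : ℂ).im / h⌋ = ⌊(w : ℂ).im / h⌋ :=
      congrArg (fun p : ℤ × M => (p.2 : ℤ)) hzw
    have h3 := Int.abs_sub_lt_one_of_floor_eq_floor h1
    have h4 := Int.abs_sub_lt_one_of_floor_eq_floor h2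
    rw [← sub_div, abs_div, abs_of_pos hh0, div_lt_one hh0] at h3 h4
    have h5 := hsep z z.2 w w.2 (fun h => hne (Subtype.ext h))
    have h6 := Complex.norm_le_abs_re_add_abs_im ((z : ℂ) - w)
    rw [Complex.sub_re, Complex.sub_im] at h6
    linarith
  have h1 : Summable fun p : ℤ × M => G p.1 * 1 :=
    Summable.mul_of_nonneg hG (Summable.of_finite (f := fun _ : M => (1 : ℝ))) hG0
      (fun _ => zero_le_one)
  have h2 : ∑' p : ℤ × M, G p.1 * 1 = (∑' n, G n) * ∑' _ : M, (1 : ℝ) :=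
    (hG.tsum_mul_tsum (Summable.of_finite (f := fun _ : M => (1 : ℝ))) h1).symm
  have hgκ : ∀ w, g w ≤ G (κ w).1 * 1 := by
    intro w
    rw [mul_one]
    exact hg w
  have hs : Summable g := Summable.of_nonneg_of_le hg0 hgκ (h1.comp_injective hκ)
  refine ⟨hs, ?_⟩
  have h3 := hs.tsum_le_tsum_of_inj κ hκ (fun p _ => by rw [mul_one]; exact hG0 p.1)
    hgκ h1
  have h4 : ∑' _ : M, (1 : ℝ) = M.card := by simp
  rw [h2, h4, mul_comm] at h3
  exact h3

theorem floor_sq_le (x : ℝ) : (⌊x⌋ : ℝ) ^ 2 ≤ 2 * x ^ 2 + 2 := by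
  have h1 := Int.floor_le x
  have h2 := Int.lt_floor_add_one x
  nlinarith [sq_nonneg (x + (x - ⌊x⌋))]

theorem UniformlyDiscrete.summable_inv_one_add_sq {Z : Set ℂ} (hZ : UniformlyDiscrete Z) {H : ℝ}
    (hH : ∀ z ∈ Z, |z.im| ≤ H) : Summable fun w : Z => (1 + (w : ℂ).re ^ 2)⁻¹ := by
  obtain ⟨h, K, hh, -, hs⟩ := hZ.exists_tsum_le hH
  refine (hs (fun n => (3 + 2 / h ^ 2) * (1 + (n : ℝ) ^ 2)⁻¹) _ (fun n => by positivity)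
    (summable_int_inv_one_add_sq.mul_left _) (fun w => by positivity) fun w => ?_).1
  have h1 := floor_sq_le ((w : ℂ).re / h)
  rw [div_pow] at h1
  rw [← div_eq_mul_inv, inv_eq_one_div, div_le_div_iff₀ (by positivity) (by positivity)]
  have h2 : 2 * ((w : ℂ).re ^ 2 / h ^ 2) = 2 / h ^ 2 * (w : ℂ).re ^ 2 := by ring
  have h3 : 0 ≤ 2 / h ^ 2 := by positivity
  nlinarith [sq_nonneg (w : ℂ).re]

theorem summable_int_exp_neg_sq {a : ℝ} (ha : 0 < a) :
    Summable fun n : ℤ => Real.exp (-Real.pi * a * (n : ℝ) ^ 2) := by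
  refine Summable.of_nonneg_of_le (fun n => (Real.exp_pos _).le) (fun n => ?_)
    (summable_int_inv_one_add_sq.mul_left (max 1 (Real.pi * a)⁻¹))
  have hpa : 0 < Real.pi * a := mul_pos Real.pi_pos ha
  have h1 := Real.add_one_le_exp (Real.pi * a * (n : ℝ) ^ 2)
  rw [show -Real.pi * a * (n : ℝ) ^ 2 = -(Real.pi * a * (n : ℝ) ^ 2) by ring, Real.exp_neg,
    ← div_eq_mul_inv, inv_eq_one_div, div_le_div_iff₀ (Real.exp_pos _) (by positivity), one_mul]
  have h2 : (1 : ℝ) ≤ max 1 (Real.pi * a)⁻¹ := le_max_left _ _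
  have h3 : 1 ≤ max 1 (Real.pi * a)⁻¹ * (Real.pi * a) := by
    rw [← inv_mul_cancel₀ hpa.ne']
    gcongr
    exact le_max_right _ _
  calc 1 + (n : ℝ) ^ 2 ≤ max 1 (Real.pi * a)⁻¹ * 1 +
        max 1 (Real.pi * a)⁻¹ * (Real.pi * a) * (n : ℝ) ^ 2 := by
        nlinarith [sq_nonneg (n : ℝ)]
    _ = max 1 (Real.pi * a)⁻¹ * (Real.pi * a * (n : ℝ) ^ 2 + 1) := by ring
    _ ≤ _ := by gcongr

/-- Gaussian sums over a uniformly discrete set have the order of the Gaussian integral. -/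
theorem UniformlyDiscrete.exists_gaussian_tsum_le {Z : Set ℂ} (hZ : UniformlyDiscrete Z) {H : ℝ}
    (hH : ∀ z ∈ Z, |z.im| ≤ H) :
    ∃ L : ℝ, ∀ ε ∈ Set.Ioc (0 : ℝ) 1,
      Summable (fun w : Z => Real.exp (-Real.pi * ε ^ 2 * (w : ℂ).re ^ 2)) ∧
        ε * ∑' w : Z, Real.exp (-Real.pi * ε ^ 2 * (w : ℂ).re ^ 2) ≤ L := by
  obtain ⟨h, K, hh, hK, hs⟩ := hZ.exists_tsum_le hH
  set L₀ := ∑' n : ℤ, Real.exp (-Real.pi * (2 / h ^ 2) * (n : ℝ) ^ 2) with hL₀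
  refine ⟨K * (Real.exp (Real.pi * h ^ 2) * (√2 / h * L₀)), fun ε hε => ?_⟩
  obtain ⟨hε0, hε1⟩ := hε
  -- Passing from the real part to its cell number by `floor_sq_le` halves the exponent and costs
  -- the factor `exp (π h²)`.
  have ha : 0 < ε ^ 2 * h ^ 2 / 2 := by positivity
  obtain ⟨h1, h2⟩ := hs
    (fun n => Real.exp (Real.pi * h ^ 2) *
      Real.exp (-Real.pi * (ε ^ 2 * h ^ 2 / 2) * (n : ℝ) ^ 2))
    (fun w : Z => Real.exp (-Real.pi * ε ^ 2 * (w : ℂ).re ^ 2)) (fun n => by positivity)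
    ((summable_int_exp_neg_sq ha).mul_left _) (fun w => by positivity) (fun w => by
      rw [← Real.exp_add]
      refine Real.exp_le_exp.2 ?_
      have h1 := floor_sq_le ((w : ℂ).re / h)
      rw [div_pow] at h1
      have h2 : h ^ 2 * (⌊(w : ℂ).re / h⌋ : ℝ) ^ 2 ≤ 2 * (w : ℂ).re ^ 2 + 2 * h ^ 2 := by
        calc h ^ 2 * (⌊(w : ℂ).re / h⌋ : ℝ) ^ 2
            ≤ h ^ 2 * (2 * ((w : ℂ).re ^ 2 / h ^ 2) + 2) := by gcongr
          _ = _ := by field_simp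
      have h3 : ε ^ 2 ≤ 1 := pow_le_one₀ hε0.le hε1
      have h4 : ε ^ 2 * (h ^ 2 * (⌊(w : ℂ).re / h⌋ : ℝ) ^ 2) ≤
          2 * (ε ^ 2 * (w : ℂ).re ^ 2) + 2 * h ^ 2 := by
        nlinarith [sq_nonneg ε, sq_nonneg h]
      nlinarith [Real.pi_pos])
  refine ⟨h1, ?_⟩
  -- Poisson summation extracts the factor `√2 / (ε h)`, which `ε` cancels; the dual theta series is
  -- largest at `ε = 1`, where it equals `L₀`.
  rw [tsum_mul_left, Real.tsum_exp_neg_mul_int_sq ha, ← Real.sqrt_eq_rpow] at h2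
  have h3 : √(ε ^ 2 * h ^ 2 / 2) = ε * h / √2 := by
    rw [Real.sqrt_div (by positivity), ← mul_pow, Real.sqrt_sq (by positivity)]
  have h4 : ∑' n : ℤ, Real.exp (-Real.pi / (ε ^ 2 * h ^ 2 / 2) * (n : ℝ) ^ 2) ≤ L₀ := by
    have h5 : ∀ n : ℤ, Real.exp (-Real.pi / (ε ^ 2 * h ^ 2 / 2) * (n : ℝ) ^ 2) ≤
        Real.exp (-Real.pi * (2 / h ^ 2) * (n : ℝ) ^ 2) := by
      intro n
      refine Real.exp_le_exp.2 ?_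
      have h6 : 2 / h ^ 2 ≤ 2 / (ε ^ 2 * h ^ 2) := by
        gcongr
        exact mul_le_of_le_one_left (sq_nonneg h) (pow_le_one₀ hε0.le hε1)
      have h7 : -Real.pi / (ε ^ 2 * h ^ 2 / 2) = -Real.pi * (2 / (ε ^ 2 * h ^ 2)) := by
        field_simp
      rw [h7]
      have : Real.pi * (2 / h ^ 2) * (n : ℝ) ^ 2 ≤
          Real.pi * (2 / (ε ^ 2 * h ^ 2)) * (n : ℝ) ^ 2 := by gcongr
      linarith
    have h8 := summable_int_exp_neg_sq (a := 2 / h ^ 2) (by positivity)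
    exact (Summable.of_nonneg_of_le (fun n => (Real.exp_pos _).le) h5 h8).tsum_le_tsum h5 h8
  rw [h3] at h2
  calc ε * ∑' w : Z, Real.exp (-Real.pi * ε ^ 2 * (w : ℂ).re ^ 2)
      ≤ ε * (K * (Real.exp (Real.pi * h ^ 2) * (1 / (ε * h / √2) * L₀))) := by
        refine mul_le_mul_of_nonneg_left (h2.trans ?_) hε0.le
        gcongr
    _ = _ := by
        field_simp

/-- The shell `n ≤ |s| < n + 1` has at most `C (n + 2) ^ m` points, so the exponent `m + 2` leaves a
series comparable to `∑ (1 + n)⁻²`. -/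
theorem HasPolynomialCount.exists_summable {S : Set ℝ} (hS : HasPolynomialCount S) :
    ∃ k : ℕ, Summable fun s : S => ((1 + |(s : ℝ)|) ^ k)⁻¹ := by
  obtain ⟨C, m, h⟩ := hS
  refine ⟨m + 2, ?_⟩
  let f : S → ℕ := fun s => ⌊|(s : ℝ)|⌋₊
  have hsub : ∀ n : ℕ, ∀ s : {s : S // f s = n},
      (s : ℝ) ∈ S ∩ Set.Ioo (-((n : ℝ) + 2)) ((n : ℝ) + 2) := by
    rintro n ⟨s, hs⟩
    refine ⟨s.2, abs_lt.1 ?_⟩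
    have := Nat.lt_floor_add_one |(s : ℝ)|
    simp only [f] at hs
    rw [hs] at this
    simp only
    linarith
  have hfin : ∀ n : ℕ, (S ∩ Set.Ioo (-((n : ℝ) + 2)) ((n : ℝ) + 2)).Finite := fun n =>
    (h _ (by linarith [n.cast_nonneg (α := ℝ)])).1
  let e : ∀ n : ℕ, {s : S // f s = n} → ↥(S ∩ Set.Ioo (-((n : ℝ) + 2)) ((n : ℝ) + 2)) :=
    fun n s => ⟨s, hsub n s⟩
  have he : ∀ n, Function.Injective (e n) := by
    intro n s t hst
    have : ((s : S) : ℝ) = (t : S) := congrArg (fun p : ↥(S ∩ Set.Ioo (-((n : ℝ) + 2)) ((n : ℝ) + 2)) => (p : ℝ)) hst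
    exact Subtype.ext (Subtype.ext this)
  have hfinite : ∀ n, Finite {s : S // f s = n} := fun n => by
    have := (hfin n).to_subtype
    exact Finite.of_injective (e n) (he n)
  have hcard : ∀ n : ℕ, (Nat.card {s : S // f s = n} : ℝ) ≤ C * ((n : ℝ) + 2) ^ m := by
    intro n
    have := (hfin n).to_subtype
    refine le_trans ?_ (h ((n : ℝ) + 2) (by linarith [n.cast_nonneg (α := ℝ)])).2
    exact_mod_cast Nat.card_le_card_of_injective (e n) (he n)
  have hC : 0 ≤ C := by
    have h1 := hcard 0
    have h2 : (0 : ℝ) ≤ Nat.card {s : S // f s = 0} := by positivity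
    have h3 : 0 ≤ C * (((0 : ℕ) : ℝ) + 2) ^ m := h2.trans h1
    exact nonneg_of_mul_nonneg_left h3 (by positivity)
  rw [← (Equiv.sigmaFiberEquiv f).summable_iff, summable_sigma_of_nonneg fun p => by
    simp only [Function.comp_apply]; positivity]
  refine ⟨fun n => Summable.of_finite, ?_⟩
  refine Summable.of_nonneg_of_le (fun n => tsum_nonneg fun s => by
    simp only [Function.comp_apply]; positivity) (fun n => ?_)
    ((summable_int_inv_one_add_sq.comp_injective Nat.cast_injective).mul_left (C * 2 ^ m))
  have := Fintype.ofFinite {s : S // f s = n}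
  rw [tsum_fintype]
  have hterm : ∀ s : {s : S // f s = n},
      ((fun s : S => ((1 + |(s : ℝ)|) ^ (m + 2))⁻¹) ∘ (Equiv.sigmaFiberEquiv f)) ⟨n, s⟩ ≤
        ((1 + (n : ℝ)) ^ (m + 2))⁻¹ := by
    rintro ⟨s, hs⟩
    simp only [Function.comp_apply, Equiv.sigmaFiberEquiv, Equiv.coe_fn_mk]
    have : (n : ℝ) ≤ |(s : ℝ)| := by
      rw [← hs]
      exact Nat.floor_le (abs_nonneg _)
    gcongr
  refine (Finset.sum_le_card_nsmul _ _ _ fun s _ => hterm s).trans ?_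
  rw [nsmul_eq_mul, Finset.card_univ, ← Nat.card_eq_fintype_card]
  calc (Nat.card {s : S // f s = n} : ℝ) * ((1 + (n : ℝ)) ^ (m + 2))⁻¹
      ≤ C * ((n : ℝ) + 2) ^ m * ((1 + (n : ℝ)) ^ (m + 2))⁻¹ := by
        gcongr
        exact hcard n
    _ ≤ C * (2 * (1 + (n : ℝ))) ^ m * ((1 + (n : ℝ)) ^ (m + 2))⁻¹ := by
        gcongr
        linarith [n.cast_nonneg (α := ℝ)]
    _ = C * 2 ^ m * ((1 + (n : ℝ)) ^ 2)⁻¹ := by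
        rw [mul_pow, pow_add]
        field_simp
    _ ≤ _ := by
        simp only [Function.comp_apply, Int.cast_natCast]
        gcongr
        nlinarith [n.cast_nonneg (α := ℝ)]

end Sums

/-! ### Decay of test functions and integrals over horizontal lines -/

section Contours

/-- Test functions decay quadratically, uniformly in horizontal strips. -/
theorem IsEntireSchwartz.exists_decay {f : ℂ → ℂ} (hf : IsEntireSchwartz f) (r : ℝ) :
    ∃ C : ℝ, ∀ z : ℂ, |z.im| ≤ r → ‖f z‖ ≤ C * (1 + z.re ^ 2)⁻¹ := by
  obtain ⟨R, hR, hrR⟩ : ∃ R : ℝ, 0 < R ∧ r ≤ R :=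
    ⟨|r| + 1, by positivity, (le_abs_self r).trans (by linarith)⟩
  obtain ⟨M, hM⟩ := hf.bounded R
  -- The factor has modulus at least `1 + (Re z)²` on the strip, as `Im z + R + 1 ≥ 1`. `F` is
  -- bounded on both edges by the Schwartz condition and grows at most quadratically inside, so
  -- Phragmén–Lindelöf bounds it throughout.
  let F : ℂ → ℂ := fun z => f z * (z + (R + 1 : ℝ) * Complex.I) ^ 2
  have hFd : Differentiable ℂ F := hf.entire.mul (by fun_prop)
  have hsq : ∀ z : ℂ, ‖(z + (R + 1 : ℝ) * Complex.I) ^ 2‖ = z.re ^ 2 + (z.im + (R + 1)) ^ 2 := by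
    intro z
    rw [norm_pow, Complex.sq_norm, Complex.normSq_apply]
    simp
    ring
  have hFn : ∀ z, ‖F z‖ = ‖f z‖ * (z.re ^ 2 + (z.im + (R + 1)) ^ 2) := fun z => by
    rw [norm_mul, hsq]
  have hline : ∀ y : ℝ, |y| ≤ R → ∃ C : ℝ, ∀ z : ℂ, z.im = y → ‖F z‖ ≤ C := by
    intro y hy
    obtain ⟨g, hg⟩ := hf.schwartz y
    refine ⟨SchwartzMap.seminorm ℂ 2 0 g + SchwartzMap.seminorm ℂ 0 0 g * (2 * R + 1) ^ 2,
      fun z hz => ?_⟩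
    have h1 : f z = g z.re := by rw [hg, ← hz, Complex.re_add_im]
    rw [hFn, h1, mul_add]
    have h2 := g.norm_pow_mul_le_seminorm ℂ 2 z.re
    rw [Real.norm_eq_abs, sq_abs] at h2
    have h3 := g.norm_le_seminorm ℂ z.re
    obtain ⟨h4, h5⟩ := abs_le.1 hy
    have h6 : (z.im + (R + 1)) ^ 2 ≤ (2 * R + 1) ^ 2 := by
      rw [hz]
      exact pow_le_pow_left₀ (by linarith) (by linarith) 2
    refine add_le_add (by rw [mul_comm]; exact h2) ?_
    exact mul_le_mul h3 h6 (sq_nonneg _) ((norm_nonneg _).trans h3)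
  obtain ⟨C₁, hC₁⟩ := hline R (abs_of_pos hR).le
  obtain ⟨C₂, hC₂⟩ := hline (-R) (by rw [abs_neg, abs_of_pos hR])
  obtain ⟨k, hk0, hk⟩ : ∃ k : ℝ, 0 < k ∧ k < Real.pi / (R - -R) :=
    exists_between (by have := Real.pi_pos; exact div_pos this (by linarith))
  have hgrowth : F =O[Filter.comap (_root_.abs ∘ Complex.re) Filter.atTop ⊓
      Filter.principal (Complex.im ⁻¹' Set.Ioo (-R) R)]
      fun z ↦ Real.exp (1 * Real.exp (k * |z.re|)) := by
    refine Asymptotics.IsBigO.of_bound (M * (2 / k ^ 2 + (2 * R + 1) ^ 2)) ?_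
    refine Filter.eventually_inf_principal.2 (Filter.Eventually.of_forall fun z hz => ?_)
    have hz' : |z.im| ≤ R := abs_le.2 ⟨hz.1.le, hz.2.le⟩
    rw [hFn, Real.norm_of_nonneg (Real.exp_pos _).le, one_mul, mul_assoc]
    have h0 := hM z hz'
    have hexp : Real.exp (k * |z.re|) ≤ Real.exp (Real.exp (k * |z.re|)) :=
      Real.exp_le_exp.2 (by linarith [Real.add_one_le_exp (k * |z.re|)])
    have h1 : z.re ^ 2 ≤ 2 / k ^ 2 * Real.exp (Real.exp (k * |z.re|)) := by
      have h2 := Real.pow_div_factorial_le_exp (k * |z.re|) (by positivity) 2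
      rw [mul_pow, sq_abs, Nat.factorial_two, Nat.cast_ofNat, div_le_iff₀ two_pos] at h2
      rw [div_mul_eq_mul_div, le_div_iff₀ (by positivity)]
      nlinarith
    have h3 : (z.im + (R + 1)) ^ 2 ≤ (2 * R + 1) ^ 2 * Real.exp (Real.exp (k * |z.re|)) := by
      have h4 : (z.im + (R + 1)) ^ 2 ≤ (2 * R + 1) ^ 2 :=
        pow_le_pow_left₀ (by linarith [hz.1]) (by linarith [hz.2]) 2
      refine h4.trans (le_mul_of_one_le_right (sq_nonneg _) ?_)
      exact Real.one_le_exp (Real.exp_pos _).le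
    refine mul_le_mul h0 ?_ (by positivity) ((norm_nonneg _).trans h0)
    linarith
  have hPL : ∀ z : ℂ, |z.im| ≤ R → ‖F z‖ ≤ max C₁ C₂ := fun z hz =>
    PhragmenLindelof.horizontal_strip hFd.diffContOnCl ⟨k, hk, 1, hgrowth⟩
      (fun z hz => (hC₂ z hz).trans (le_max_right _ _))
      (fun z hz => (hC₁ z hz).trans (le_max_left _ _)) (abs_le.1 hz).1 (abs_le.1 hz).2
  refine ⟨max C₁ C₂, fun z hz => ?_⟩
  have h1 := hPL z (hz.trans hrR)
  have h2 : 1 + z.re ^ 2 ≤ z.re ^ 2 + (z.im + (R + 1)) ^ 2 := by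
    nlinarith [(abs_le.1 (hz.trans hrR)).1]
  rw [← div_eq_mul_inv, le_div_iff₀ (by positivity)]
  refine le_trans ?_ h1
  rw [hFn]
  gcongr

theorem IsEntireSchwartz.integrable {f : ℂ → ℂ} (hf : IsEntireSchwartz f) (y : ℝ) :
    MeasureTheory.Integrable fun x : ℝ => f (x + y * Complex.I) := by
  obtain ⟨g, hg⟩ := hf.schwartz y
  rw [← funext hg]
  exact g.integrable

/-- Integrals over the boundaries of rectangles that exhaust a horizontal strip. -/
theorem tendsto_rectIntegral {F : ℂ → ℂ} {C c d : ℝ} {T T' : ℕ → ℝ}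
    (hT : ∀ n : ℕ, (n : ℝ) ≤ T n) (hT' : ∀ n : ℕ, T' n ≤ -(n : ℝ))
    (hc : MeasureTheory.Integrable fun x : ℝ => F (x + c * Complex.I))
    (hd : MeasureTheory.Integrable fun x : ℝ => F (x + d * Complex.I))
    (hv : ∀ n, ∀ y ∈ Set.uIcc c d, ‖F (T n + y * Complex.I)‖ ≤ C * (1 + (T n) ^ 2)⁻¹)
    (hv' : ∀ n, ∀ y ∈ Set.uIcc c d, ‖F (T' n + y * Complex.I)‖ ≤ C * (1 + (T' n) ^ 2)⁻¹) :
    Filter.Tendsto (fun n => rectIntegral F (T' n) (T n) c d) Filter.atTop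
      (nhds ((∫ x : ℝ, F (x + c * Complex.I)) - ∫ x : ℝ, F (x + d * Complex.I))) := by
  have h1 : Filter.Tendsto T Filter.atTop Filter.atTop :=
    Filter.tendsto_atTop_mono hT tendsto_natCast_atTop_atTop
  have h2 : Filter.Tendsto T' Filter.atTop Filter.atBot :=
    Filter.tendsto_atBot_mono hT'
      (Filter.tendsto_neg_atTop_atBot.comp tendsto_natCast_atTop_atTop)
  have hvert : ∀ t : ℕ → ℝ, Filter.Tendsto (fun n => (t n) ^ 2) Filter.atTop Filter.atTop →
      (∀ n, ∀ y ∈ Set.uIcc c d, ‖F (t n + y * Complex.I)‖ ≤ C * (1 + (t n) ^ 2)⁻¹) →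
      Filter.Tendsto (fun n => Complex.I • ∫ y : ℝ in c..d, F (t n + y * Complex.I)) Filter.atTop
        (nhds 0) := by
    intro t ht h
    rw [← smul_zero Complex.I]
    refine Filter.Tendsto.const_smul ?_ _
    refine squeeze_zero_norm (a := fun n => C * (1 + (t n) ^ 2)⁻¹ * |d - c|) (fun n =>
      intervalIntegral.norm_integral_le_of_norm_le_const fun y hy =>
        h n y (Set.uIoc_subset_uIcc hy)) ?_
    have h3 : Filter.Tendsto (fun n => (1 + (t n) ^ 2)⁻¹) Filter.atTop (nhds 0) :=
      Filter.Tendsto.inv_tendsto_atTop (Filter.tendsto_atTop_add_const_left _ _ ht)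
    simpa using (h3.const_mul C).mul_const |d - c|
  have h3 := hvert T ((Filter.tendsto_pow_atTop two_ne_zero).comp h1) hv
  have h4 := hvert T' (by
    have := (Filter.tendsto_pow_atTop (α := ℝ) two_ne_zero).comp
      (Filter.tendsto_neg_atBot_atTop.comp h2)
    simpa [Function.comp_def] using this) hv'
  have h5 := MeasureTheory.intervalIntegral_tendsto_integral hc h2 h1
  have h6 := MeasureTheory.intervalIntegral_tendsto_integral hd h2 h1
  simpa [rectIntegral] using ((h5.sub h6).add h3).sub h4

/-- Shift of the line of integration. -/
theorem integral_eq_integral_add_mul_I {F : ℂ → ℂ} (hF : Differentiable ℂ F) {H C : ℝ}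
    (h : ∀ z : ℂ, |z.im| ≤ |H| → ‖F z‖ ≤ C * (1 + z.re ^ 2)⁻¹) :
    ∫ x : ℝ, F (x + H * Complex.I) = ∫ x : ℝ, F x := by
  have hint : ∀ y : ℝ, |y| ≤ |H| →
      MeasureTheory.Integrable fun x : ℝ => F (x + y * Complex.I) := by
    intro y hy
    refine (integrable_inv_one_add_sq.const_mul C).mono'
      (hF.continuous.comp (by fun_prop)).aestronglyMeasurable (Filter.Eventually.of_forall fun x => ?_)
    simpa using h (x + y * Complex.I) (by simpa using hy)
  have huIcc : ∀ y ∈ Set.uIcc 0 H, |y| ≤ |H| := by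
    intro y hy
    rcases Set.mem_uIcc.1 hy with ⟨h1, h2⟩ | ⟨h1, h2⟩
    · rwa [abs_of_nonneg h1, abs_of_nonneg (h1.trans h2)]
    · rw [abs_of_nonpos h2, abs_of_nonpos (h1.trans h2)]
      linarith
  have hlim := tendsto_rectIntegral (F := F) (C := C) (c := 0) (d := H) (T := fun n => n)
    (T' := fun n => -n) (fun n => le_rfl) (fun n => le_rfl) (hint 0 (by simp)) (hint H le_rfl)
    (fun n y hy => by simpa using h (n + y * Complex.I) (by simpa using huIcc y hy))
    (fun n y hy => by simpa using h (-n + y * Complex.I) (by simpa using huIcc y hy))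
  simp only [rectIntegral_eq_zero hF.differentiableOn] at hlim
  have := tendsto_nhds_unique hlim tendsto_const_nhds
  simpa using (sub_eq_zero.1 this).symm

/-- Moving the line to the real axis leaves a Fourier integral; the argument is `-s` because the
kernel of `𝓕` is `exp (-2πi s x)`. -/
theorem IsEntireSchwartz.integral_mul_exp {f : ℂ → ℂ} (hf : IsEntireSchwartz f) (s H : ℝ) :
    ∫ x : ℝ, f (x + H * Complex.I) *
      Complex.exp (2 * Real.pi * Complex.I * s * (x + H * Complex.I)) =
        𝓕 (fun x : ℝ => f x) (-s) := by
  obtain ⟨C, hC⟩ := hf.exists_decay |H|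
  rw [integral_eq_integral_add_mul_I
    (F := fun z => f z * Complex.exp (2 * Real.pi * Complex.I * s * z))
    (hf.entire.mul (by fun_prop)) (C := C * Real.exp (2 * Real.pi * |s| * |H|)),
    Real.fourier_real_eq_integral_exp_smul]
  · refine MeasureTheory.integral_congr_ae (Filter.Eventually.of_forall fun x => ?_)
    simp only [smul_eq_mul]
    rw [mul_comm]
    congr 2
    push_cast
    ring
  · intro z hz
    rw [norm_mul, norm_exp_freq, mul_right_comm C]
    refine mul_le_mul (hC z hz) (Real.exp_le_exp.2 ?_) (Real.exp_pos _).le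
      ((norm_nonneg _).trans (hC z hz))
    calc -(2 * Real.pi * s) * z.im ≤ |-(2 * Real.pi * s) * z.im| := le_abs_self _
      _ = 2 * Real.pi * |s| * |z.im| := by
        rw [abs_mul, abs_neg, abs_mul, abs_of_pos Real.two_pi_pos]
      _ ≤ _ := by gcongr

/-- The integral of a test function against an absolutely convergent exponential series on a
horizontal line. -/
theorem IsEntireSchwartz.hasSum_line {f : ℂ → ℂ} (hf : IsEntireSchwartz f) {ι : Type} [Countable ι]
    {c : ι → ℂ} {σ : ι → ℝ} {H : ℝ} {Q : ℂ → ℂ} (hQ : ∀ z : ℂ, z.im = H →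
      Summable (fun i => ‖c i * Complex.exp (2 * Real.pi * Complex.I * σ i * z)‖) ∧
      HasSum (fun i => c i * Complex.exp (2 * Real.pi * Complex.I * σ i * z)) (Q z)) :
    HasSum (fun i => c i * 𝓕 (fun x : ℝ => f x) (-σ i))
        (∫ x : ℝ, f (x + H * Complex.I) * Q (x + H * Complex.I)) ∧
      ∃ W : ℝ, ∀ z : ℂ, z.im = H → ‖Q z‖ ≤ W := by
  have him : ∀ x : ℝ, ((x : ℂ) + H * Complex.I).im = H := fun x => by simp
  -- The modulus of each term is constant along the line, so summability at one point is uniform;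
  -- this justifies termwise integration and bounds `Q`.
  let w : ι → ℝ := fun i => ‖c i‖ * Real.exp (-(2 * Real.pi * σ i) * H)
  have hw : ∀ z : ℂ, z.im = H → ∀ i,
      ‖c i * Complex.exp (2 * Real.pi * Complex.I * σ i * z)‖ = w i := fun z hz i => by
    rw [norm_mul, norm_exp_freq, hz]
  have hws : Summable w := by
    have := (hQ _ (him 0)).1
    simpa only [hw _ (him 0)] using this
  refine ⟨?_, ∑' i, w i, fun z hz => ?_⟩
  · let F : ι → ℝ → ℂ := fun i x => f (x + H * Complex.I) *
      (c i * Complex.exp (2 * Real.pi * Complex.I * σ i * (x + H * Complex.I)))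
    have hFn : ∀ i x, ‖F i x‖ = ‖f (x + H * Complex.I)‖ * w i := fun i x => by
      rw [norm_mul, hw _ (him x)]
    have hcont : Continuous f := hf.entire.continuous
    have h1 : ∀ i, MeasureTheory.Integrable (F i) := by
      intro i
      refine ((hf.integrable H).norm.mul_const (w i)).mono'
        (Continuous.aestronglyMeasurable (by fun_prop)) (Filter.Eventually.of_forall fun x => ?_)
      exact (hFn i x).le
    have h2 : Summable fun i => ∫ x, ‖F i x‖ := by
      simp only [hFn, MeasureTheory.integral_mul_const]
      exact hws.mul_left _
    have h3 := MeasureTheory.hasSum_integral_of_summable_integral_norm h1 h2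
    have h4 : ∀ i, ∫ x, F i x = c i * 𝓕 (fun x : ℝ => f x) (-σ i) := by
      intro i
      rw [← hf.integral_mul_exp (σ i) H, ← MeasureTheory.integral_const_mul]
      refine MeasureTheory.integral_congr_ae (Filter.Eventually.of_forall fun x => ?_)
      simp only [F]
      ring
    have h5 : ∀ x : ℝ, ∑' i, F i x = f (x + H * Complex.I) * Q (x + H * Complex.I) := fun x =>
      ((hQ _ (him x)).2.mul_left _).tsum_eq
    simpa only [h4, h5] using h3
  · rw [← (hQ z hz).2.tsum_eq]
    have := hQ z hz
    refine (norm_tsum_le_tsum_norm this.1).trans_eq ?_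
    simp only [hw z hz]

end Contours

/-! ### The formula for entire test functions -/

section Formula

theorem ExpPolySimple.exists_ne_zero {φ : ℂ → ℂ} (hφ : φ ∈ ExpPolySimple) : ∃ z, φ z ≠ 0 := by
  by_contra! h
  refine hφ.2.1 0 (h 0) ?_
  rw [show φ = fun _ => 0 from funext h, deriv_const]

/-- Every point with `|Re w| ≤ R` contributes at least `(1 + R²)⁻¹`. Hence each rectangle encloses
finitely many poles. -/
theorem finite_of_summable_inv_one_add_sq {Z : Set ℂ}
    (h : Summable fun w : Z => (1 + (w : ℂ).re ^ 2)⁻¹) (R : ℝ) :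
    {w : Z | |(w : ℂ).re| ≤ R}.Finite := by
  have h1 := h.tendsto_cofinite_zero.eventually
    (gt_mem_nhds (show (0 : ℝ) < (1 + R ^ 2)⁻¹ by positivity))
  refine (Filter.eventually_cofinite.1 h1).subset fun w hw => not_lt.2 ?_
  have : (w : ℂ).re ^ 2 ≤ R ^ 2 := sq_le_sq' (abs_le.1 hw).1 (abs_le.1 hw).2
  gcongr

/-- The sum over the zeros is the difference of the integrals over two horizontal lines that
enclose them. -/
theorem hasSum_zeros_eq_integral {ψ φ f : ℂ → ℂ} (hψ : ψ ∈ ExpPoly) (hφ : φ ∈ ExpPolySimple)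
    (hf : IsEntireSchwartz f) {H W M : ℝ} (hH : 0 < H) (hzero : ∀ w ∈ zeroSet φ, |w.im| < H)
    (hQ : ∀ z : ℂ, |z.im| = H → ‖ψ z / φ z‖ ≤ W)
    (hM : ∀ w ∈ zeroSet φ, ‖ψ w / deriv φ w‖ ≤ M) :
    Summable (fun w : zeroSet φ => ψ w / deriv φ w * f w) ∧
      2 * Real.pi * Complex.I * ∑' w : zeroSet φ, ψ w / deriv φ w * f w =
        (∫ x : ℝ, f (x + (-H : ℝ) * Complex.I) *
          (ψ (x + (-H : ℝ) * Complex.I) / φ (x + (-H : ℝ) * Complex.I))) -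
        ∫ x : ℝ, f (x + H * Complex.I) * (ψ (x + H * Complex.I) / φ (x + H * Complex.I)) := by
  have hne := ExpPolySimple.exists_ne_zero hφ
  obtain ⟨hE, hsimple, hUD⟩ := hφ
  have hψd := ExpPoly.differentiable hψ
  have hφd := ExpPoly.differentiable hE
  obtain ⟨C, hC⟩ := hf.exists_decay H
  have hS := hUD.summable_inv_one_add_sq fun w hw => (hzero w hw).le
  have hsum : Summable (fun w : zeroSet φ => ψ w / deriv φ w * f w) := by
    refine Summable.of_norm_bounded (hS.mul_left (M * C)) fun w => ?_
    rw [norm_mul, mul_assoc]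
    exact mul_le_mul (hM w w.2) (hC w (hzero w w.2).le) (norm_nonneg _)
      ((norm_nonneg _).trans (hM w w.2))
  refine ⟨hsum, ?_⟩
  obtain ⟨η, hη, hvert⟩ := ExpPoly.exists_vertical_lower_bound hE hne H
  obtain ⟨Mψ, hMψ⟩ : ∃ Mψ : ℝ, ∀ z : ℂ, |z.im| ≤ H → ‖ψ z‖ ≤ Mψ := by
    obtain ⟨A, p, -, rfl⟩ := exists_eq_expSum hψ
    exact exists_norm_expSum_le A p H
  -- The vertical sides lie in `(n, n + 1)` and `(-n - 1, -n)`, at abscissas where `|φ| ≥ η`; in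
  -- particular no zero lies on them.
  choose T hT hTη using fun n : ℕ => hvert n
  choose T' hT' hTη' using fun n : ℕ => hvert (-(n : ℝ) - 1)
  let G : ℂ → ℂ := fun z => f z * ψ z / φ z
  have hvG : ∀ t : ℝ, (∀ y : ℝ, |y| ≤ H → η ≤ ‖φ (t + y * Complex.I)‖) →
      ∀ y ∈ Set.uIcc (-H) H, ‖G (t + y * Complex.I)‖ ≤ (C * Mψ / η) * (1 + t ^ 2)⁻¹ := by
    intro t ht y hy
    rw [Set.uIcc_of_le (by linarith)] at hy
    have hy' : |y| ≤ H := abs_le.2 hy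
    have h1 := hC (t + y * Complex.I) (by simpa using hy')
    have h2 := hMψ (t + y * Complex.I) (by simpa using hy')
    have h3 := ht y hy'
    simp only [Complex.add_re, Complex.ofReal_re, Complex.mul_re, Complex.I_re, mul_zero,
      Complex.ofReal_im, Complex.I_im, mul_one, sub_self, add_zero] at h1
    rw [norm_div, norm_mul]
    calc ‖f (t + y * Complex.I)‖ * ‖ψ (t + y * Complex.I)‖ / ‖φ (t + y * Complex.I)‖
        ≤ ((C * (1 + t ^ 2)⁻¹) * Mψ) / η :=
          div_le_div₀ (mul_nonneg ((norm_nonneg _).trans h1) ((norm_nonneg _).trans h2))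
            (mul_le_mul h1 h2 (norm_nonneg _) ((norm_nonneg _).trans h1)) hη h3
      _ = _ := by ring
  have hne_line : ∀ z : ℂ, |z.im| = H → φ z ≠ 0 := fun z hz h0 => (hzero z h0).ne hz
  have hint : ∀ h : ℝ, |h| = H → MeasureTheory.Integrable fun x : ℝ => G (x + h * Complex.I) := by
    intro h hh
    have him : ∀ x : ℝ, |((x : ℂ) + h * Complex.I).im| = H := fun x => by simpa using hh
    refine ((hf.integrable h).norm.mul_const W).mono' (Continuous.aestronglyMeasurable ?_)
      (Filter.Eventually.of_forall fun x => ?_)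
    · have := hf.entire.continuous
      have := hψd.continuous
      have := hφd.continuous
      exact Continuous.div (by fun_prop) (by fun_prop) fun x => hne_line _ (him x)
    · simp only [G]
      rw [mul_div_assoc, norm_mul]
      gcongr
      exact hQ _ (him x)
  have hlim := tendsto_rectIntegral (F := G) (c := -H) (d := H) (fun n => (hT n).1.le)
    (fun n => by linarith [(hT' n).2]) (hint (-H) (by rw [abs_neg, abs_of_pos hH]))
    (hint H (abs_of_pos hH)) (fun n => hvG (T n) (hTη n)) (fun n => hvG (T' n) (hTη' n))
  have hTpos : ∀ n, 0 < T n := fun n => lt_of_le_of_lt n.cast_nonneg (hT n).1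
  have hTneg : ∀ n, T' n < 0 := fun n => by linarith [(hT' n).2, n.cast_nonneg (α := ℝ)]
  have hfin : ∀ n, {w : zeroSet φ | (w : ℂ).re ∈ Set.Ioo (T' n) (T n)}.Finite := fun n =>
    (finite_of_summable_inv_one_add_sq hS (max |T' n| |T n|)).subset fun w hw =>
      abs_le_max_abs_abs hw.1.le hw.2.le
  let Z : ℕ → Finset (zeroSet φ) := fun n => (hfin n).toFinset
  have hZ : Filter.Tendsto Z Filter.atTop Filter.atTop := by
    refine Filter.tendsto_atTop.2 fun s => ?_
    have : ∀ w ∈ s, ∀ᶠ n : ℕ in Filter.atTop, w ∈ Z n := by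
      intro w _
      filter_upwards [tendsto_natCast_atTop_atTop.eventually (Filter.eventually_ge_atTop
        |(w : ℂ).re|)] with n hn
      obtain ⟨h1, h2⟩ := abs_le.1 hn
      refine (hfin n).mem_toFinset.2 ⟨?_, ?_⟩
      · linarith [(hT' n).2]
      · linarith [(hT n).1]
    exact (Filter.eventually_all_finset s).2 this
  have hrect : ∀ n, rectIntegral G (T' n) (T n) (-H) H =
      2 * Real.pi * Complex.I * ∑ w ∈ Z n, ψ w / deriv φ w * f w := by
    intro n
    have h1 := rectIntegral_div (hf.entire.mul hψd) hφd ((hTneg n).trans (hTpos n)).le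
      (show -H ≤ H by linarith) ((Z n).map (Function.Embedding.subtype _)) (by
        intro w hw
        obtain ⟨v, hv, rfl⟩ := Finset.mem_map.1 hw
        exact ⟨v.2, hsimple v v.2, (hfin n).mem_toFinset.1 hv, abs_lt.1 (hzero v v.2)⟩) (by
        intro w hw hw' h0
        refine Finset.mem_map.2 ⟨⟨w, h0⟩, (hfin n).mem_toFinset.2 ⟨?_, ?_⟩, rfl⟩
        · refine lt_of_le_of_ne hw.1 fun h => ?_
          have h2 := hTη' n w.im (abs_le.2 hw')
          rw [h, Complex.re_add_im, h0, norm_zero] at h2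
          linarith
        · refine lt_of_le_of_ne hw.2 fun h => ?_
          have h2 := hTη n w.im (abs_le.2 hw')
          rw [← h, Complex.re_add_im, h0, norm_zero] at h2
          linarith)
    rw [Finset.sum_map] at h1
    refine Eq.trans h1 (congrArg _ (Finset.sum_congr rfl fun w _ => ?_))
    simp only [Function.Embedding.subtype_apply, Pi.mul_apply]
    ring
  simp only [hrect] at hlim
  have hlim' := (Filter.Tendsto.comp hsum.hasSum hZ).const_mul (2 * Real.pi * Complex.I)
  have h := tendsto_nhds_unique hlim' hlim
  rw [h]
  simp only [G, mul_div_assoc]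

/-- The summation formula for entire test functions, with the dual side indexed by words. -/
theorem exists_formula {ψ φ : ℂ → ℂ} (hψ : ψ ∈ ExpPoly) (hφ : φ ∈ ExpPolySimple) :
    ∃ (H M : ℝ) (ι : Type) (B : ι → ℂ) (t : ι → ℝ), (∀ w ∈ zeroSet φ, |w.im| ≤ H) ∧
      (∀ w ∈ zeroSet φ, ‖ψ w / deriv φ w‖ ≤ M) ∧ HasPolynomialCount (Set.range t) ∧
      ∀ f : ℂ → ℂ, IsEntireSchwartz f →
        Summable (fun w : zeroSet φ => ψ w / deriv φ w * f w) ∧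
        HasSum (fun i => B i * 𝓕 (fun x : ℝ => f x) (t i))
          (∑' w : zeroSet φ, ψ w / deriv φ w * f w) := by
  have hne := ExpPolySimple.exists_ne_zero hφ
  obtain ⟨ι₁, _, c₁, σ₁, H₁, hcount₁, h₁⟩ := exists_expansion_upper hψ hφ.1 hne
  -- Reflection in the origin turns the lower half-plane into the upper one.
  obtain ⟨ι₂, _, c₂, σ₂, H₂, hcount₂, h₂⟩ := exists_expansion_upper (ExpPoly.comp_neg hψ)
    (ExpPoly.comp_neg hφ.1) (by
      obtain ⟨z, hz⟩ := hne
      exact ⟨-z, by simpa using hz⟩)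
  obtain ⟨H, hH, hH₁, hH₂⟩ : ∃ H : ℝ, 0 < H ∧ H₁ ≤ H ∧ H₂ ≤ H :=
    ⟨max 1 (max H₁ H₂), by positivity, (le_max_left _ _).trans (le_max_right _ _),
      (le_max_right _ _).trans (le_max_right _ _)⟩
  have hzero : ∀ w ∈ zeroSet φ, |w.im| < H := by
    intro w hw
    refine abs_lt.2 ⟨?_, ?_⟩ <;> by_contra! h
    · refine (h₂ (-w) (by rw [Complex.neg_im]; linarith)).1 ?_
      rw [neg_neg]
      exact hw
    · exact (h₁ w (hH₁.trans h)).1 hw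
  obtain ⟨κ, hκ, hderiv⟩ := ExpPolySimple.exists_le_norm_deriv hφ hne H
  obtain ⟨Mψ, hMψ⟩ : ∃ Mψ : ℝ, ∀ z : ℂ, |z.im| ≤ H → ‖ψ z‖ ≤ Mψ := by
    obtain ⟨A, p, -, rfl⟩ := exists_eq_expSum hψ
    exact exists_norm_expSum_le A p H
  have hM : ∀ w ∈ zeroSet φ, ‖ψ w / deriv φ w‖ ≤ Mψ / κ := by
    intro w hw
    have h := hMψ w (hzero w hw).le
    rw [norm_div]
    exact div_le_div₀ ((norm_nonneg _).trans h) h hκ (hderiv w hw (hzero w hw).le)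
  -- The upper side is traversed backwards, hence the minus sign, and a frequency `σ₁` on it yields
  -- `-σ₁`. On the lower side the reflection has already negated the frequency, so `σ₂` survives.
  refine ⟨H, Mψ / κ, ι₁ ⊕ ι₂,
    Sum.elim (fun i => -(2 * Real.pi * Complex.I)⁻¹ * c₁ i)
      (fun i => (2 * Real.pi * Complex.I)⁻¹ * c₂ i),
    Sum.elim (fun i => -σ₁ i) σ₂, fun w hw => (hzero w hw).le, hM, ?_, fun f hf => ?_⟩
  · rw [Set.Sum.elim_range]
    refine HasPolynomialCount.union ?_ hcount₂
    have := hcount₁.neg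
    rwa [← Set.range_comp] at this
  · obtain ⟨hup, W₁, hW₁⟩ := hf.hasSum_line (H := H) (Q := fun z => ψ z / φ z)
      (fun z hz => (h₁ z (by rw [hz]; exact hH₁)).2)
    obtain ⟨hdown, W₂, hW₂⟩ := hf.hasSum_line (c := c₂) (σ := fun i => -σ₂ i) (H := -H)
      (Q := fun z => ψ z / φ z) (fun z hz => by
        have h3 := (h₂ (-z) (by rw [Complex.neg_im, hz, neg_neg]; exact hH₂)).2
        have h4 : ∀ i, 2 * Real.pi * Complex.I * σ₂ i * -z =
            2 * Real.pi * Complex.I * ((-σ₂ i : ℝ) : ℂ) * z := fun i => by push_cast; ring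
        simpa only [h4, neg_neg] using h3)
    obtain ⟨hs, hres⟩ := hasSum_zeros_eq_integral hψ hφ hf (W := max W₁ W₂) hH hzero (by
      intro z hz
      rcases (abs_eq hH.le).1 hz with h | h
      · exact (hW₁ z h).trans (le_max_left _ _)
      · exact (hW₂ z h).trans (le_max_right _ _)) hM
    refine ⟨hs, ?_⟩
    have hpi : (2 * Real.pi * Complex.I : ℂ) ≠ 0 := Complex.two_pi_I_ne_zero
    have h5 : ∑' w : zeroSet φ, ψ w / deriv φ w * f w =
        -(2 * Real.pi * Complex.I)⁻¹ *
          (∫ x : ℝ, f (x + H * Complex.I) * (ψ (x + H * Complex.I) / φ (x + H * Complex.I))) +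
        (2 * Real.pi * Complex.I)⁻¹ * (∫ x : ℝ, f (x + (-H : ℝ) * Complex.I) *
          (ψ (x + (-H : ℝ) * Complex.I) / φ (x + (-H : ℝ) * Complex.I))) := by
      rw [neg_mul, neg_add_eq_sub, ← mul_sub, ← hres, inv_mul_cancel_left₀ hpi]
    rw [h5]
    refine HasSum.sum ?_ ?_
    · simpa [Function.comp_def, mul_assoc] using hup.mul_left (-(2 * Real.pi * Complex.I)⁻¹)
    · simpa [Function.comp_def, mul_assoc] using hdown.mul_left ((2 * Real.pi * Complex.I)⁻¹)

/-- Grouping the terms of a series by the values of a function of the index. -/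
theorem tsum_range_fiber {ι : Type*} (B : ι → ℂ) (t : ι → ℝ) (F : ℝ → ℂ) {A : ℂ}
    (h : HasSum (fun i => B i * F (t i)) A) :
    HasSum (fun s : Set.range t =>
      (∑' i : {i // Set.rangeFactorization t i = s}, B i) * F s) A := by
  let e := Equiv.sigmaFiberEquiv (Set.rangeFactorization t)
  have h1 := e.hasSum_iff.2 h
  have h2 := h1.summable.sigma
  have h3 := h1.summable.tsum_sigma
  rw [h1.tsum_eq] at h3
  rw [h3]
  have h4 : ∀ s : Set.range t,
      ∑' i, ((fun i => B i * F (t i)) ∘ e) ⟨s, i⟩ =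
        (∑' i : {i // Set.rangeFactorization t i = s}, B i) * F s := by
    intro s
    -- This needs no summability of `B` on the fibre: for `F s = 0` both sides vanish, and otherwise
    -- summability is equivalent on both sides.
    rw [← tsum_mul_right]
    refine tsum_congr ?_
    rintro ⟨i, rfl⟩
    rfl
  simp only [h4] at h2 ⊢
  exact h2.hasSum

end Formula

/-! ### Real zeros: bounded coefficients and extension to Schwartz functions -/

section RealZeros

/-- Multiplied by `ε`, the transform is `1` at `s₀` and tends to `0` elsewhere as `ε → 0`, which
singles out one dual coefficient. -/
theorem fourier_gaussian_shift {ε : ℝ} (hε : 0 < ε) (s₀ s : ℝ) :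
    𝓕 (fun x : ℝ => Complex.exp (-(Real.pi * ε ^ 2 : ℝ) * x ^ 2 +
      2 * Real.pi * Complex.I * s₀ * x + 0)) s =
        (ε : ℂ)⁻¹ * (Real.exp (-Real.pi / ε ^ 2 * (s - s₀) ^ 2) : ℝ) := by
  have h := congrFun (fourier_gaussian_pi' (b := ((ε ^ 2 : ℝ) : ℂ))
    (by rw [Complex.ofReal_re]; positivity) (Complex.I * s₀)) s
  have h1 : (((ε ^ 2 : ℝ) : ℂ)) ^ (1 / 2 : ℂ) = ε := by
    rw [show (1 / 2 : ℂ) = ((1 / 2 : ℝ) : ℂ) by push_cast; rfl,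
      ← Complex.ofReal_cpow (by positivity), ← Real.sqrt_eq_rpow, Real.sqrt_sq hε.le]
  rw [h1, one_div] at h
  have h2 : (fun x : ℝ => Complex.exp (-(Real.pi * ε ^ 2 : ℝ) * x ^ 2 +
      2 * Real.pi * Complex.I * s₀ * x + 0)) = fun x : ℝ =>
        Complex.exp (-Real.pi * ((ε ^ 2 : ℝ) : ℂ) * x ^ 2 +
          2 * Real.pi * (Complex.I * s₀) * x) := by
    funext x
    congr 1
    push_cast
    ring
  rw [h2, h]
  congr 1
  push_cast
  congr 1
  linear_combination (-(Real.pi : ℂ) / ε ^ 2) *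
    (2 * s * s₀ + (Complex.I ^ 2 - 1) * s₀ ^ 2) * Complex.I_sq

/-- The coefficients of a summation formula over a uniformly discrete set of reals with bounded
weights are bounded. -/
theorem bounded_dual_coefficients {Z : Set ℂ} (hZ : UniformlyDiscrete Z)
    (hreal : ∀ w ∈ Z, w.im = 0) {c : Z → ℂ} {M : ℝ} (hM : ∀ w, ‖c w‖ ≤ M) {S : Set ℝ} {a : S → ℂ}
    (hform : ∀ f : ℂ → ℂ, IsEntireSchwartz f →
      HasSum (fun s : S => a s * 𝓕 (fun x : ℝ => f x) (s : ℝ)) (∑' w : Z, c w * f w)) :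
    ∃ A : ℝ, ∀ s, ‖a s‖ ≤ A := by
  classical
  obtain ⟨L, hL⟩ := hZ.exists_gaussian_tsum_le (H := 0) (fun w hw => by rw [hreal w hw, abs_zero])
  refine ⟨|M| * L, fun s₀ => ?_⟩
  let g : ℝ → ℝ → ℝ := fun ε s => Real.exp (-Real.pi / ε ^ 2 * (s - s₀) ^ 2)
  have key : ∀ ε ∈ Set.Ioc (0 : ℝ) 1, ∃ A : ℂ, ‖A‖ ≤ |M| * L ∧
      HasSum (fun s : S => a s * (g ε s : ℂ)) A := by
    intro ε hε
    have hb : 0 < Real.pi * ε ^ 2 := mul_pos Real.pi_pos (pow_pos hε.1 2)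
    have h1 := (hform _ (isEntireSchwartz_cexp_quadratic hb
      (2 * Real.pi * Complex.I * (s₀ : ℝ)) 0)).mul_left (ε : ℂ)
    refine ⟨_, ?_, h1.congr_fun fun s => ?_⟩
    · obtain ⟨h2, h3⟩ := hL ε hε
      rw [norm_mul, Complex.norm_real, Real.norm_of_nonneg hε.1.le]
      have h4 : ‖∑' w : Z, c w * Complex.exp (-((Real.pi * ε ^ 2 : ℝ) : ℂ) * (w : ℂ) ^ 2 +
          2 * Real.pi * Complex.I * (s₀ : ℝ) * w + 0)‖ ≤
          ∑' w : Z, |M| * Real.exp (-Real.pi * ε ^ 2 * (w : ℂ).re ^ 2) := by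
        refine tsum_of_norm_bounded (h2.mul_left |M|).hasSum fun w => ?_
        have h5 := norm_cexp_quadratic (Real.pi * ε ^ 2) (2 * Real.pi * Complex.I * (s₀ : ℝ)) 0
          (w : ℂ).re (w : ℂ).im
        rw [Complex.re_add_im, hreal w w.2] at h5
        rw [norm_mul, h5]
        refine mul_le_mul ((hM w).trans (le_abs_self M)) (le_of_eq ?_) (Real.exp_pos _).le
          (abs_nonneg M)
        congr 1
        simp
      rw [tsum_mul_left] at h4
      calc _ ≤ ε * (|M| * ∑' w : Z, Real.exp (-Real.pi * ε ^ 2 * (w : ℂ).re ^ 2)) :=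
            mul_le_mul_of_nonneg_left h4 hε.1.le
        _ = |M| * (ε * ∑' w : Z, Real.exp (-Real.pi * ε ^ 2 * (w : ℂ).re ^ 2)) := by ring
        _ ≤ _ := mul_le_mul_of_nonneg_left h3 (abs_nonneg M)
    · rw [fourier_gaussian_shift hε.1]
      have : (ε : ℂ) ≠ 0 := by exact_mod_cast hε.1.ne'
      simp only [g]
      field_simp
  -- `g ε s` increases with `ε`, so the series at `ε = 1` dominates all the others.
  obtain ⟨A₁, -, hA₁⟩ := key 1 ⟨one_pos, le_rfl⟩
  have hev : ∀ᶠ ε : ℝ in nhdsWithin 0 (Set.Ioi 0), ε ∈ Set.Ioc (0 : ℝ) 1 :=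
    Ioc_mem_nhdsGT one_pos
  have hlim : Filter.Tendsto (fun ε => ∑' s : S, a s * (g ε s : ℂ)) (nhdsWithin 0 (Set.Ioi 0))
      (nhds (∑' s : S, if s = s₀ then a s else 0)) := by
    refine tendsto_tsum_of_dominated_convergence hA₁.summable.norm (fun s => ?_) ?_
    · by_cases hs : s = s₀
      · simp [hs, g]
      · rw [if_neg hs]
        have hs' : 0 < Real.pi * ((s : ℝ) - s₀) ^ 2 :=
          mul_pos Real.pi_pos (sq_pos_of_ne_zero (sub_ne_zero.2 fun h => hs (Subtype.ext h)))
        have h1 : Filter.Tendsto (fun ε : ℝ => (ε ^ 2)⁻¹) (nhdsWithin 0 (Set.Ioi 0))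
            Filter.atTop := by
          have := (Filter.tendsto_pow_atTop (α := ℝ) two_ne_zero).comp tendsto_inv_nhdsGT_zero
          simpa [Function.comp_def] using this
        have h2 : Filter.Tendsto (fun ε => g ε s) (nhdsWithin 0 (Set.Ioi 0)) (nhds 0) := by
          refine Real.tendsto_exp_atBot.comp ?_
          have := h1.const_mul_atTop_of_neg (neg_neg_of_pos hs')
          refine this.congr fun ε => ?_
          rw [div_eq_mul_inv]
          ring
        have h3 := ((Complex.continuous_ofReal.tendsto 0).comp h2).const_mul (a s)
        simpa [Function.comp_def] using h3
    · filter_upwards [hev] with ε hε s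
      rw [norm_mul, norm_mul]
      refine mul_le_mul_of_nonneg_left ?_ (norm_nonneg _)
      rw [Complex.norm_real, Complex.norm_real, Real.norm_of_nonneg (Real.exp_pos _).le,
        Real.norm_of_nonneg (Real.exp_pos _).le]
      refine Real.exp_le_exp.2 (mul_le_mul_of_nonneg_right ?_ (sq_nonneg _))
      rw [neg_div, neg_div]
      refine neg_le_neg (div_le_div_of_nonneg_left Real.pi_pos.le (pow_pos hε.1 2) ?_)
      exact pow_le_pow_left₀ hε.1.le hε.2 2
  rw [tsum_ite_eq] at hlim
  refine le_of_tendsto hlim.norm ?_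
  filter_upwards [hev] with ε hε
  obtain ⟨A, hA, hA'⟩ := key ε hε
  rwa [hA'.tsum_eq]

/-- The convolution of a Schwartz function with a test function is a test function. -/
theorem IsEntireSchwartz.convolution {k : ℂ → ℂ} (hk : IsEntireSchwartz k) (f : 𝓢(ℝ, ℂ)) :
    IsEntireSchwartz (fun z => ∫ t : ℝ, f t * k (z - t)) ∧
      ∀ s : ℝ, 𝓕 (fun x : ℝ => ∫ t : ℝ, f t * k ((x : ℂ) - t)) s =
        𝓕 (fun x : ℝ => f x) s * 𝓕 (fun x : ℝ => k x) s := by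
  have hcont := hk.entire.continuous
  have hconv : ∀ (y : ℝ) (g : 𝓢(ℝ, ℂ)), (∀ x : ℝ, g x = k (x + y * Complex.I)) → ∀ x : ℝ,
      MeasureTheory.convolution f g (ContinuousLinearMap.mul ℂ ℂ) MeasureTheory.volume x =
        ∫ t : ℝ, f t * k ((x + y * Complex.I) - t) := by
    intro y g hg x
    refine MeasureTheory.integral_congr_ae (Filter.Eventually.of_forall fun t => ?_)
    simp only [ContinuousLinearMap.mul_apply', hg]
    congr 2
    push_cast
    ring
  refine ⟨⟨fun z₀ => ?_, fun y => ?_, fun r => ?_⟩, fun s => ?_⟩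
  · obtain ⟨M, hM⟩ := hk.bounded (|z₀.im| + 2)
    have hder : ∀ w : ℂ, |w.im| ≤ |z₀.im| + 1 → ‖deriv k w‖ ≤ M := by
      intro w hw
      have := Complex.norm_deriv_le_of_forall_mem_sphere_norm_le one_pos
        (hk.entire.diffContOnCl (s := Metric.ball w 1)) (C := M) fun z hz => hM z (by
          have h1 := Complex.abs_im_le_norm (z - w)
          rw [mem_sphere_iff_norm.1 hz, Complex.sub_im] at h1
          have h2 := abs_sub_abs_le_abs_sub z.im w.im
          linarith)
      simpa using this
    have hM0 : ∀ t : ℝ, ‖k (z₀ - t)‖ ≤ M := fun t => hM _ (by simp)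
    refine (hasDerivAt_integral_of_dominated_loc_of_deriv_le
      (F := fun z (t : ℝ) => f t * k (z - t)) (F' := fun z (t : ℝ) => f t * deriv k (z - t))
      (bound := fun t => ‖f t‖ * M)
      (Metric.ball_mem_nhds z₀ one_pos) ?_ ?_ ?_ ?_ ?_ ?_).2.differentiableAt
    · refine Filter.Eventually.of_forall fun z => Continuous.aestronglyMeasurable ?_
      have := f.continuous
      fun_prop
    · refine (f.integrable.norm.mul_const M).mono' (Continuous.aestronglyMeasurable ?_)
        (Filter.Eventually.of_forall fun t => ?_)
      · have := f.continuous
        fun_prop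
      · rw [norm_mul]
        exact mul_le_mul_of_nonneg_left (hM0 t) (norm_nonneg _)
    · refine Continuous.aestronglyMeasurable ?_
      have := f.continuous
      have : Continuous (deriv k) := hk.entire.contDiff.continuous_deriv le_rfl
      fun_prop
    · refine Filter.Eventually.of_forall fun t z hz => ?_
      rw [norm_mul]
      refine mul_le_mul_of_nonneg_left (hder _ ?_) (norm_nonneg _)
      have h1 := Complex.abs_im_le_norm (z - z₀)
      have h2 := mem_ball_iff_norm.1 hz
      rw [Complex.sub_im] at h1
      have h3 := abs_sub_abs_le_abs_sub z.im z₀.im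
      simp only [Complex.sub_im, Complex.ofReal_im, sub_zero]
      linarith
    · exact f.integrable.norm.mul_const M
    · refine Filter.Eventually.of_forall fun t z _ => ?_
      have := (hk.entire (z - t)).hasDerivAt.comp z ((hasDerivAt_id z).sub_const (t : ℂ))
      simpa [Function.comp_def] using this.const_mul (f t)
  · obtain ⟨g, hg⟩ := hk.schwartz y
    refine ⟨SchwartzMap.convolution (ContinuousLinearMap.mul ℂ ℂ) f g, fun x => ?_⟩
    rw [SchwartzMap.convolution_apply, hconv y g hg]
  · obtain ⟨M, hM⟩ := hk.bounded r
    refine ⟨∫ t : ℝ, ‖f t‖ * M, fun z hz => ?_⟩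
    refine MeasureTheory.norm_integral_le_of_norm_le (f.integrable.norm.mul_const M)
      (Filter.Eventually.of_forall fun t => ?_)
    rw [norm_mul]
    exact mul_le_mul_of_nonneg_left (hM _ (by simpa using hz)) (norm_nonneg _)
  · obtain ⟨g, hg⟩ := hk.schwartz 0
    have h1 : (fun x : ℝ => ∫ t : ℝ, f t * k ((x : ℂ) - t)) =
        MeasureTheory.convolution f g (ContinuousLinearMap.mul ℂ ℂ) MeasureTheory.volume := by
      funext x
      rw [hconv 0 g hg]
      simp
    have h2 : (fun x : ℝ => k x) = g := by
      funext x
      rw [hg]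
      simp
    rw [h1, Real.fourier_mul_convolution_eq f.integrable g.integrable, h2]

theorem SchwartzMap.exists_pow_decay (f : 𝓢(ℝ, ℂ)) (k : ℕ) :
    ∃ C : ℝ, ∀ x : ℝ, ‖f x‖ ≤ C * ((1 + |x|) ^ k)⁻¹ := by
  refine ⟨2 ^ k * ((Finset.Iic (k, 0)).sup fun m => SchwartzMap.seminorm ℂ m.1 m.2) f,
    fun x => ?_⟩
  have h := SchwartzMap.one_add_le_sup_seminorm_apply (𝕜 := ℂ) (m := (k, 0)) (le_refl k)
    (le_refl 0) f x
  rw [norm_iteratedFDeriv_zero, Real.norm_eq_abs] at h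
  rw [← div_eq_mul_inv, le_div_iff₀ (by positivity), mul_comm]
  exact h

/-- The mollification of `f` at scale `ε` by a Gaussian. -/
noncomputable def mollify (f : 𝓢(ℝ, ℂ)) (ε x : ℝ) : ℂ :=
  ∫ u : ℝ, f (x - ε * u) * Real.exp (-Real.pi * u ^ 2)

/-- Substitution `t = x - εu`. The zero linear and constant terms match the form in
`isEntireSchwartz_cexp_quadratic` and `fourier_gaussian_shift`. -/
theorem integral_gaussian_kernel (f : 𝓢(ℝ, ℂ)) {ε : ℝ} (hε : 0 < ε) (x : ℝ) :
    ∫ t : ℝ, f t * Complex.exp (-(Real.pi * ε⁻¹ ^ 2 : ℝ) * ((x : ℂ) - t) ^ 2 +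
      2 * Real.pi * Complex.I * (0 : ℝ) * ((x : ℂ) - t) + 0) = ε * mollify f ε x := by
  let g : ℝ → ℂ := fun v => f (x - v) * Real.exp (-Real.pi * (ε⁻¹ * v) ^ 2)
  have h1 : ∫ t : ℝ, f t * Complex.exp (-(Real.pi * ε⁻¹ ^ 2 : ℝ) * ((x : ℂ) - t) ^ 2 +
      2 * Real.pi * Complex.I * (0 : ℝ) * ((x : ℂ) - t) + 0) = ∫ t : ℝ, g (x - t) := by
    refine MeasureTheory.integral_congr_ae (Filter.Eventually.of_forall fun t => ?_)
    simp only [g, sub_sub_cancel]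
    congr 1
    push_cast
    congr 1
    ring
  rw [h1, MeasureTheory.integral_sub_left_eq_self g]
  have h2 := MeasureTheory.Measure.integral_comp_mul_left g ε
  have h3 : ∫ u : ℝ, g (ε * u) = mollify f ε x := by
    refine MeasureTheory.integral_congr_ae (Filter.Eventually.of_forall fun u => ?_)
    simp only [g, inv_mul_cancel_left₀ hε.ne']
  rw [h3] at h2
  rw [h2, abs_of_pos (inv_pos.2 hε), Complex.real_smul, Complex.ofReal_inv,
    mul_inv_cancel_left₀ (by exact_mod_cast hε.ne')]

theorem integrable_one_add_sq_mul_gaussian :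
    MeasureTheory.Integrable fun u : ℝ => (1 + u ^ 2) * Real.exp (-Real.pi * u ^ 2) := by
  have h1 : MeasureTheory.Integrable fun u : ℝ => Real.exp (-Real.pi * u ^ 2) :=
    integrable_exp_neg_mul_sq Real.pi_pos
  have h2 : MeasureTheory.Integrable fun u : ℝ => u ^ 2 * Real.exp (-Real.pi * u ^ 2) := by
    have := integrable_rpow_mul_exp_neg_mul_sq Real.pi_pos (s := 2) (by norm_num)
    simpa using this
  refine (h1.add h2).congr (Filter.Eventually.of_forall fun u => ?_)
  simp only [Pi.add_apply]
  ring

/-- For `ε ≤ 1`, `1 + x² ≤ 2 (1 + u²)(1 + (x - εu)²)`: the decay of `f` passes to `x` at the cost of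
`1 + u²`, which the Gaussian absorbs. Uniformity in `ε` serves dominated convergence. -/
theorem exists_mollify_decay (f : 𝓢(ℝ, ℂ)) :
    ∃ C : ℝ, ∀ ε ∈ Set.Ioc (0 : ℝ) 1, ∀ x : ℝ, ‖mollify f ε x‖ ≤ C * (1 + x ^ 2)⁻¹ := by
  obtain ⟨C, hC⟩ := SchwartzMap.exists_pow_decay f 2
  have hC0 : 0 ≤ C := by
    have := (norm_nonneg _).trans (hC 0)
    simpa using this
  refine ⟨∫ u : ℝ, 2 * C * ((1 + u ^ 2) * Real.exp (-Real.pi * u ^ 2)), fun ε hε x => ?_⟩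
  rw [← MeasureTheory.integral_mul_const]
  refine MeasureTheory.norm_integral_le_of_norm_le
    ((integrable_one_add_sq_mul_gaussian.const_mul (2 * C)).mul_const _)
    (Filter.Eventually.of_forall fun u => ?_)
  rw [norm_mul, Complex.norm_real, Real.norm_of_nonneg (Real.exp_pos _).le]
  have h1 : ((1 + |x - ε * u|) ^ 2)⁻¹ ≤ 2 * (1 + u ^ 2) * (1 + x ^ 2)⁻¹ := by
    rw [← div_eq_mul_inv, inv_eq_one_div, div_le_div_iff₀ (by positivity) (by positivity)]
    have h2 : 1 + (x - ε * u) ^ 2 ≤ (1 + |x - ε * u|) ^ 2 := by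
      nlinarith [abs_nonneg (x - ε * u), sq_abs (x - ε * u)]
    have h3 : (ε * u) ^ 2 ≤ u ^ 2 := by
      rw [mul_pow]
      exact mul_le_of_le_one_left (sq_nonneg u) (pow_le_one₀ hε.1.le hε.2)
    have h4 : x ^ 2 ≤ 2 * (x - ε * u) ^ 2 + 2 * (ε * u) ^ 2 := by
      nlinarith [sq_nonneg (x - 2 * (ε * u))]
    have h5 : 1 + x ^ 2 ≤ 2 * (1 + u ^ 2) * (1 + (x - ε * u) ^ 2) := by
      nlinarith [mul_nonneg (sq_nonneg u) (sq_nonneg (x - ε * u))]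
    calc 1 * (1 + x ^ 2) ≤ 2 * (1 + u ^ 2) * (1 + (x - ε * u) ^ 2) := by rw [one_mul]; exact h5
      _ ≤ _ := by gcongr
  calc ‖f (x - ε * u)‖ * Real.exp (-Real.pi * u ^ 2)
      ≤ (C * (2 * (1 + u ^ 2) * (1 + x ^ 2)⁻¹)) * Real.exp (-Real.pi * u ^ 2) := by
        refine mul_le_mul_of_nonneg_right ((hC _).trans ?_) (Real.exp_pos _).le
        exact mul_le_mul_of_nonneg_left h1 hC0
    _ = _ := by ring

theorem tendsto_mollify (f : 𝓢(ℝ, ℂ)) (x : ℝ) :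
    Filter.Tendsto (fun ε => mollify f ε x) (nhdsWithin 0 (Set.Ioi 0)) (nhds (f x)) := by
  have hint : ∫ u : ℝ, f x * (Real.exp (-Real.pi * u ^ 2) : ℝ) = f x := by
    rw [MeasureTheory.integral_const_mul, integral_complex_ofReal, integral_gaussian,
      div_self Real.pi_ne_zero]
    simp
  rw [← hint]
  have hf := f.continuous
  refine MeasureTheory.tendsto_integral_filter_of_dominated_convergence
    (fun u => SchwartzMap.seminorm ℂ 0 0 f * Real.exp (-Real.pi * u ^ 2)) ?_ ?_
    ((integrable_exp_neg_mul_sq Real.pi_pos).const_mul _) ?_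
  · exact Filter.Eventually.of_forall fun ε => Continuous.aestronglyMeasurable (by fun_prop)
  · refine Filter.Eventually.of_forall fun ε => Filter.Eventually.of_forall fun u => ?_
    rw [norm_mul, Complex.norm_real, Real.norm_of_nonneg (Real.exp_pos _).le]
    exact mul_le_mul_of_nonneg_right (f.norm_le_seminorm ℂ _) (Real.exp_pos _).le
  · refine Filter.Eventually.of_forall fun u => ?_
    have h1 : Continuous fun ε : ℝ => f (x - ε * u) * (Real.exp (-Real.pi * u ^ 2) : ℝ) := by
      fun_prop
    have h2 := h1.tendsto 0
    rw [zero_mul, sub_zero] at h2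
    exact h2.mono_left nhdsWithin_le_nhds

/-- A summation formula for entire test functions over a uniformly discrete set of reals extends
to all Schwartz functions. -/
theorem formula_of_schwartz {Z : Set ℂ} (hZ : UniformlyDiscrete Z)
    (hreal : ∀ w ∈ Z, w.im = 0) {c : Z → ℂ} {M : ℝ} (hM : ∀ w, ‖c w‖ ≤ M) {S : Set ℝ}
    (hS : HasPolynomialCount S) {a : S → ℂ} {A : ℝ} (hA : ∀ s, ‖a s‖ ≤ A)
    (hform : ∀ f : ℂ → ℂ, IsEntireSchwartz f →
      HasSum (fun s : S => a s * 𝓕 (fun x : ℝ => f x) (s : ℝ)) (∑' w : Z, c w * f w))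
    (f : 𝓢(ℝ, ℂ)) :
    Summable (fun w : Z => c w * f (w : ℂ).re) ∧
      Summable (fun s : S => a s * 𝓕 (fun x : ℝ => f x) (s : ℝ)) ∧
      ∑' w : Z, c w * f (w : ℂ).re = ∑' s : S, a s * 𝓕 (fun x : ℝ => f x) (s : ℝ) := by
  have hZs := hZ.summable_inv_one_add_sq (H := 0) (fun w hw => by rw [hreal w hw, abs_zero])
  obtain ⟨C, hC⟩ := exists_mollify_decay f
  have hev : ∀ᶠ ε : ℝ in nhdsWithin 0 (Set.Ioi 0), ε ∈ Set.Ioc (0 : ℝ) 1 :=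
    Ioc_mem_nhdsGT one_pos
  have hbound : ∀ ε ∈ Set.Ioc (0 : ℝ) 1, ∀ w : Z,
      ‖c w * mollify f ε (w : ℂ).re‖ ≤ M * C * (1 + (w : ℂ).re ^ 2)⁻¹ := by
    intro ε hε w
    rw [norm_mul, mul_assoc]
    exact mul_le_mul (hM w) (hC ε hε _) (norm_nonneg _) ((norm_nonneg _).trans (hM w))
  have hpt : ∀ w : Z, Filter.Tendsto (fun ε => c w * mollify f ε (w : ℂ).re)
      (nhdsWithin 0 (Set.Ioi 0)) (nhds (c w * f (w : ℂ).re)) := fun w =>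
    (tendsto_mollify f _).const_mul _
  have hs₁ : Summable (fun w : Z => c w * f (w : ℂ).re) := by
    refine Summable.of_norm_bounded (hZs.mul_left (M * C)) fun w => ?_
    refine le_of_tendsto (hpt w).norm ?_
    filter_upwards [hev] with ε hε
    exact hbound ε hε w
  have hl₁ := tendsto_tsum_of_dominated_convergence (hZs.mul_left (M * C)) hpt (by
    filter_upwards [hev] with ε hε
    exact hbound ε hε)
  obtain ⟨k, hk⟩ := hS.exists_summable
  obtain ⟨C', hC'⟩ := SchwartzMap.exists_pow_decay (𝓕 f) k
  have hb₂ : ∀ s : S, ‖a s * 𝓕 (fun x : ℝ => f x) (s : ℝ)‖ ≤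
      A * C' * ((1 + |(s : ℝ)|) ^ k)⁻¹ := by
    intro s
    rw [norm_mul, mul_assoc]
    refine mul_le_mul (hA s) ?_ (norm_nonneg _) ((norm_nonneg _).trans (hA s))
    have := hC' s
    rwa [SchwartzMap.fourier_coe] at this
  have hs₂ : Summable (fun s : S => a s * 𝓕 (fun x : ℝ => f x) (s : ℝ)) :=
    Summable.of_norm_bounded (hk.mul_left _) hb₂
  refine ⟨hs₁, hs₂, ?_⟩
  -- Mollifying multiplies the Fourier transform by `exp (-π ε² s²) ≤ 1`, so the limiting series
  -- itself dominates.
  have hl₂ : Filter.Tendsto (fun ε : ℝ => ∑' s : S, a s * 𝓕 (fun x : ℝ => f x) (s : ℝ) *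
      (Real.exp (-Real.pi * ε ^ 2 * (s : ℝ) ^ 2) : ℝ)) (nhdsWithin 0 (Set.Ioi 0))
      (nhds (∑' s : S, a s * 𝓕 (fun x : ℝ => f x) (s : ℝ))) := by
    refine tendsto_tsum_of_dominated_convergence hs₂.norm (fun s => ?_) ?_
    · have h1 : Continuous fun ε : ℝ => a s * 𝓕 (fun x : ℝ => f x) (s : ℝ) *
          (Real.exp (-Real.pi * ε ^ 2 * (s : ℝ) ^ 2) : ℝ) := by fun_prop
      have h2 := h1.tendsto 0
      simp only [ne_eq, OfNat.ofNat_ne_zero, not_false_eq_true, zero_pow, mul_zero, zero_mul,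
        Real.exp_zero, Complex.ofReal_one, mul_one] at h2
      exact h2.mono_left nhdsWithin_le_nhds
    · refine Filter.Eventually.of_forall fun ε s => ?_
      rw [norm_mul, Complex.norm_real, Real.norm_of_nonneg (Real.exp_pos _).le]
      refine mul_le_of_le_one_right (norm_nonneg _) (Real.exp_le_one_iff.2 ?_)
      have := Real.pi_pos
      have : 0 ≤ Real.pi * ε ^ 2 * (s : ℝ) ^ 2 := by positivity
      linarith
  refine tendsto_nhds_unique hl₁ (hl₂.congr' ?_)
  filter_upwards [hev] with ε hε
  have hε0 : (ε : ℂ) ≠ 0 := by exact_mod_cast hε.1.ne'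
  have hb : 0 < Real.pi * ε⁻¹ ^ 2 := mul_pos Real.pi_pos (pow_pos (inv_pos.2 hε.1) 2)
  -- The kernel `exp (-π x² / ε²)` is not normalised; both sides carry its mass `ε`, which is
  -- cancelled below.
  obtain ⟨h1, h2⟩ := (isEntireSchwartz_cexp_quadratic hb
    (2 * Real.pi * Complex.I * (0 : ℝ)) 0).convolution f
  have h3 := (hform _ h1).tsum_eq
  have h4 : ∀ w : Z, ∫ t : ℝ, f t * Complex.exp (-(Real.pi * ε⁻¹ ^ 2 : ℝ) * ((w : ℂ) - t) ^ 2 +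
      2 * Real.pi * Complex.I * (0 : ℝ) * ((w : ℂ) - t) + 0) =
        ε * mollify f ε (w : ℂ).re := by
    intro w
    rw [← integral_gaussian_kernel f hε.1]
    have : (w : ℂ) = ((w : ℂ).re : ℂ) := Complex.ext rfl (by simpa using hreal w w.2)
    rw [← this]
  simp only [h2, h4, fourier_gaussian_shift (inv_pos.2 hε.1), mul_left_comm _ (ε : ℂ),
    Complex.ofReal_inv, inv_inv] at h3
  rw [tsum_mul_left, tsum_mul_left] at h3
  have h5 := mul_left_cancel₀ hε0 h3
  rw [← h5]
  refine tsum_congr fun s => ?_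
  rw [mul_assoc]
  congr 4
  simp [div_eq_mul_inv]

end RealZeros

/-- In `ℂ`, `Summable` means absolute convergence, and local finiteness of `S` is part of
`HasPolynomialCount`. In the last clause the zeros are real, so `f` is evaluated at `w.re`. -/
theorem theorem1 (ψ φ : ℂ → ℂ) (hψ : ψ ∈ ExpPoly) (hφ : φ ∈ ExpPolySimple)
    (hsub : ¬ zeroSet φ ⊆ zeroSet ψ) :
    (∃ M : ℝ, ∀ w ∈ zeroSet φ, ‖ψ w / deriv φ w‖ ≤ M) ∧
    ∃ (S : Set ℝ) (a : S → ℂ), HasPolynomialCount S ∧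
      (∀ f : ℂ → ℂ, IsEntireSchwartz f →
        Summable (fun w : zeroSet φ => ψ w / deriv φ w * f w) ∧
        Summable (fun s : S => a s * 𝓕 (fun x : ℝ => f x) (s : ℝ)) ∧
        ∑' w : zeroSet φ, ψ w / deriv φ w * f w =
          ∑' s : S, a s * 𝓕 (fun x : ℝ => f x) (s : ℝ)) ∧
      (φ ∈ ExpPolyReal →
        (∃ M : ℝ, ∀ s : S, ‖a s‖ ≤ M) ∧
        ∀ f : 𝓢(ℝ, ℂ),
          Summable (fun w : zeroSet φ => ψ w / deriv φ w * f (w : ℂ).re) ∧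
          Summable (fun s : S => a s * 𝓕 (fun x : ℝ => f x) (s : ℝ)) ∧
          ∑' w : zeroSet φ, ψ w / deriv φ w * f (w : ℂ).re =
            ∑' s : S, a s * 𝓕 (fun x : ℝ => f x) (s : ℝ)) := by
  obtain ⟨H, M, ι, B, t, -, hM, hcount, hform⟩ := exists_formula hψ hφ
  have hform' : ∀ f : ℂ → ℂ, IsEntireSchwartz f →
      HasSum (fun s : Set.range t =>
        (∑' i : {i // Set.rangeFactorization t i = s}, B i) * 𝓕 (fun x : ℝ => f x) (s : ℝ))
        (∑' w : zeroSet φ, ψ w / deriv φ w * f w) := fun f hf =>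
    tsum_range_fiber B t _ (hform f hf).2
  -- Different words may share a frequency; `a s` is the sum over the fibre of `t` above `s`, chosen
  -- before any assumption of real zeros.
  refine ⟨⟨M, hM⟩, Set.range t, fun s => ∑' i : {i // Set.rangeFactorization t i = s}, B i, hcount,
    fun f hf => ⟨(hform f hf).1, (hform' f hf).summable, (hform' f hf).tsum_eq.symm⟩, fun hR => ?_⟩
  obtain ⟨A, hA⟩ := bounded_dual_coefficients hφ.2.2 hR.2
    (c := fun w : zeroSet φ => ψ w / deriv φ w) (fun w => hM w w.2) hform'
  exact ⟨⟨A, hA⟩, formula_of_schwartz hφ.2.2 hR.2 (fun w => hM w w.2) hcount hA hform'⟩
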